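/- For a real matrix $A=\begin{bmatrix}a&b\\c&d\end{bmatrix}$ let \[\mathrm{CD}(A)=\bar D\Big(\tfrac{a+d}2+\tfrac{c-b}2\,\mathrm i,\ \sqrt{(\tfrac{a-d}2)^2+(\tfrac{b+c}2)^2}\Big)\subset\mathbb C\] be its chiral disk, where $D(z,r)$ and $\bar D(z,r)$ denote the open and the closed disk of center $z$ and radius $r$. For an atomless $\mathrm M_2(\mathbb R)$-valued measure $\phi$ on a compact interval $[\alpha,\beta]$ let \[\mathrm{Lexp}(\phi)=\sum_{n\ge0}\ \int_{\alpha\le s_1\le\dots\le s_n\le\beta}\phi(s_n)\cdots\phi(s_1)\] be its left time-ordered exponential, and let $\int\|\phi\|_2$ be its cumulative norm, i.e. its total variation with respect to the operator norm induced by the Euclidean norm of $\mathbb R^2$. The Magnus exponent of $A$ is \[\mathrm{MP}(A)=\inf\Big\{\int\|\phi\|_2\ :\ \mathrm{Lexp}(\phi)=A\Big\}\in[0,\infty],\] the infimum being over all such intervals and measures. Theorem. Suppose that $A\in \mathrm M_2(\mathbb R)$ satisfies $\mathrm{CD}(A)\subset\exp D(0,\pi)$. Then $\mathrm{MP}(A)$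 is finite, and \[\mathrm{MP}(A)=\inf\{\lambda\in[0,\pi)\ :\ \mathrm{CD}(A)\subset\exp\bar D(0,\lambda)\},\] where the infimum is attained (it is a minimum). In other words, \[\mathrm{MP}(A)=\sup\{|\log z|\ :\ z\in\mathrm{CD}(A)\},\] where $\log$ is the principal branch of the logarithm. -/

import Mathlib

open MeasureTheory Set
open scoped ENNReal

namespace Magnus

noncomputable section

/-- The `n`-th iterated ordered integral of an algebra-valued measure `φ`,
`∫_{a ≤ s₁ ≤ ⋯ ≤ sₙ ≤ t} φ(sₙ) ⋯ φ(s₁)`, as a function of the upper end `t`. The integrand is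
paired with the measure by multiplication, with the measure as the left factor. -/
def lexpTerm {𝔄 : Type*} [NormedRing 𝔄] [NormedAlgebra ℝ 𝔄]
    (φ : VectorMeasure ℝ 𝔄) (a : ℝ) : ℕ → ℝ → 𝔄
  | 0 => fun _ => 1
  | n + 1 => fun t =>
      VectorMeasure.integral (φ.restrict (Icc a t)) (fun s => lexpTerm φ a n s)
        (ContinuousLinearMap.mul ℝ 𝔄).flip

/-- The left time-ordered exponential of `φ` on `[a, b]`:
`∑ₙ ∫_{a ≤ s₁ ≤ ⋯ ≤ sₙ ≤ b} φ(sₙ) ⋯ φ(s₁)`. -/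
def lexp {𝔄 : Type*} [NormedRing 𝔄] [NormedAlgebra ℝ 𝔄]
    (φ : VectorMeasure ℝ 𝔄) (a b : ℝ) : 𝔄 :=
  ∑' n : ℕ, lexpTerm φ a n b

open scoped Matrix.Norms.L2Operator in
/-- `φ`, considered on the interval `[a, b]`, is a Magnus presentation of the real `2 × 2` matrix
`A`: it is a continuous (atomless) matrix-valued measure on `[a, b]` whose left time-ordered
exponential is `A`. -/
def IsPresentation (A : Matrix (Fin 2) (Fin 2) ℝ) (a b : ℝ)
    (φ : VectorMeasure ℝ (Matrix (Fin 2) (Fin 2) ℝ)) : Prop :=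
  a ≤ b ∧ (∀ x ∈ Icc a b, φ {x} = 0) ∧ lexp φ a b = A

open scoped Matrix.Norms.L2Operator in
/-- The cumulative norm `∫ ‖φ‖₂` over `[a, b]`: the total variation of `φ` on `[a, b]` with respect
to the operator norm that comes from the Euclidean norm of `ℝ²`. -/
def cumulativeNorm (a b : ℝ) (φ : VectorMeasure ℝ (Matrix (Fin 2) (Fin 2) ℝ)) : ℝ≥0∞ :=
  φ.variation (Icc a b)

/-- The Magnus exponent: the infimum of the cumulative norms of the Magnus presentations of `A`
(infinite if there is none). -/
def magnusExponent (A : Matrix (Fin 2) (Fin 2) ℝ) : ℝ≥0∞ :=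
  sInf {v : ℝ≥0∞ | ∃ (a b : ℝ) (φ : VectorMeasure ℝ (Matrix (Fin 2) (Fin 2) ℝ)),
    IsPresentation A a b φ ∧ v = cumulativeNorm a b φ}

/-- The chiral disk of a real `2 × 2` matrix. -/
def chiralDisk (A : Matrix (Fin 2) (Fin 2) ℝ) : Set ℂ :=
  Metric.closedBall
    (⟨(A 0 0 + A 1 1) / 2, (A 1 0 - A 0 1) / 2⟩ : ℂ)
    (Real.sqrt (((A 0 0 - A 1 1) / 2) ^ 2 + ((A 0 1 + A 1 0) / 2) ^ 2))

end

end Magnus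

/-! ### Distribution functions of atomless finite measures. -/

namespace Magnus

section Distribution

/-! Identify ℝ² with ℂ and write A v = p v + q v̄. Then CD(A) is the closed disk about p of radius
|q|, and A v / v = p + q v̄/v runs through its boundary circle. The hypothesis keeps the disk off
the branch cut, so by compactness |log| attains its maximum l on it, at some z₀. The claim is MP(A)
= l.

Lower bound (`norm_log_action_lexp_le`, `norm_log_le_cumulativeNorm`): the time-ordered exponential
solves a Volterra equation, so over a short interval of variation δ the vector u(t) = Lexp(t) v
moves by at most δ/(1-δ) |u|. The logarithms of the successive ratios of u are therefore at most δ +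
O(δ²) in modulus. Refining the partition shows that u(b)/v has logarithms of modulus arbitrarily
little above the total variation, and the principal one is the shortest. Apply this with u(b)/v =
z₀, which lies on the boundary circle.

Upper bound: write log z₀ = l e^{iθ}, c = cos θ, ω = sin θ. Maximality makes the disk tangent at z₀
to the level curve of |log|, so its radius r determines its center (`sub_center_eq_of_isMax`). It
also forces r ≤ sinh(cl)/c, since a larger disk would contain points of larger |log|
(`radius_le_sinhDiv`). Conversely, the flows with coefficient v ↦ (1-ρ)(c+iω) v + ρ k e^{2iωt} v̄,
|k| = 1, have norm at most 1 and reach at time l disks tangent in the same way. As ρ runs through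
[0,1] their radii fill [0, sinh(cl)/c], and k adjusts the phase of q, so one of them ends at A
(`magnusExponent_flow_le`, `magnusExponent_le_of_tangent`). -/

theorem monotone_measureReal_Iic (ν : Measure ℝ) [IsFiniteMeasure ν] :
    Monotone fun t => ν.real (Iic t) :=
  fun _ _ h => measureReal_mono (Iic_subset_Iic.2 h)

theorem continuous_measureReal_Iic (ν : Measure ℝ) [IsFiniteMeasure ν] [NullSingletonClass ν] :
    Continuous fun t => ν.real (Iic t) := by
  have h1 : (fun t => ν.real (Iic t)) =
      fun t => ν.real (Iic 0) + ∫ _ in (0 : ℝ)..t, (1 : ℝ) ∂ν := by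
    funext t
    rw [← intervalIntegral.integral_Iic_sub_Iic (by simp) (by simp)]
    simp [Measure.real]
  rw [h1]
  exact continuous_const.add
    (intervalIntegral.continuous_primitive (fun _ _ => intervalIntegrable_const) 0)

/-- The probability integral transform for a compactly supported atomless finite measure. -/
theorem map_measureReal_Iic (ν : Measure ℝ) [IsFiniteMeasure ν] [NullSingletonClass ν] {a b : ℝ}
    (ha : ν.real (Iic a) = 0) (hb : ν.real (Iic b) = ν.real univ) :
    ν.map (fun t => ν.real (Iic t)) = volume.restrict (Icc 0 (ν.real univ)) := by
  have hc := continuous_measureReal_Iic ν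
  have hm := monotone_measureReal_Iic ν
  have hle : ∀ t, ν.real (Iic t) ≤ ν.real univ := fun t => measureReal_mono (subset_univ _)
  refine Measure.ext_of_Iic _ _ fun x => ?_
  rw [Measure.map_apply hc.measurable measurableSet_Iic, Measure.restrict_apply measurableSet_Iic]
  rcases lt_or_ge x 0 with hx0 | hx0
  · have h1 : (fun t => ν.real (Iic t)) ⁻¹' Iic x = ∅ := by
      ext t
      simpa using hx0.trans_le measureReal_nonneg
    have h2 : Iic x ∩ Icc 0 (ν.real univ) = ∅ := by
      ext t
      simp only [mem_inter_iff, mem_Iic, mem_Icc, mem_empty_iff_false, iff_false]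
      rintro ⟨h, h', -⟩
      linarith
    simp [h1, h2]
  rcases le_or_gt (ν.real univ) x with hx1 | hx1
  · have h1 : (fun t => ν.real (Iic t)) ⁻¹' Iic x = univ := by
      ext t
      simpa using (hle t).trans hx1
    have h2 : Iic x ∩ Icc 0 (ν.real univ) = Icc 0 (ν.real univ) :=
      inter_eq_right.2 fun t ht => ht.2.trans hx1
    rw [h1, h2, Real.volume_Icc, sub_zero, ofReal_measureReal]
  · set S := (fun t => ν.real (Iic t)) ⁻¹' Iic x
    have hS : IsClosed S := isClosed_Iic.preimage hc
    have hbd : BddAbove S := ⟨b, fun t ht => by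
      by_contra! h
      have h3 := hm h.le
      have h4 : ν.real (Iic t) ≤ x := ht
      simp only [hb] at h3
      linarith⟩
    have hab : a ≤ b := by
      by_contra! h
      have h3 := hm h.le
      simp only [hb, ha] at h3
      linarith
    obtain ⟨s, -, hs⟩ : x ∈ (fun t => ν.real (Iic t)) '' Icc a b := by
      apply intermediate_value_Icc hab hc.continuousOn
      simp only [ha, hb]
      exact ⟨hx0, hx1.le⟩
    have hsS : s ∈ S := le_of_eq hs
    have hmax : sSup S ∈ S := hS.csSup_mem ⟨s, hsS⟩ hbd
    have hSI : S = Iic (sSup S) := by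
      ext t
      refine ⟨fun h => le_csSup hbd h, fun h => ?_⟩
      exact (hm h).trans hmax
    -- The value `x` is taken somewhere on `S`, so by monotonicity it is the value at the right end,
    -- even if the function is flat there.
    have hval : ν.real (Iic (sSup S)) = x :=
      le_antisymm hmax (hs.symm.le.trans (hm (le_csSup hbd hsS)))
    have h2 : Iic x ∩ Icc 0 (ν.real univ) = Icc 0 x := by
      ext t
      simp only [mem_inter_iff, mem_Iic, mem_Icc]
      constructor
      · rintro ⟨h, h', -⟩
        exact ⟨h', h⟩
      · rintro ⟨h, h'⟩
        exact ⟨h', h, by linarith⟩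
    rw [hSI, h2, Real.volume_Icc, sub_zero, ← hval, ofReal_measureReal]

/-- The distribution function carries the measure restricted to `Iic t` to Lebesgue measure on an
interval, which leaves the integral of a monomial. Iteration produces the factorials in the Volterra
bounds. -/
theorem integral_measureReal_Iic_pow (ν : Measure ℝ) [IsFiniteMeasure ν] [NullSingletonClass ν] {a : ℝ}
    (ha : ν.real (Iic a) = 0) (t : ℝ) (n : ℕ) :
    ∫ s in Iic t, ν.real (Iic s) ^ n ∂ν = ν.real (Iic t) ^ (n + 1) / (n + 1) := by
  have hμ : ∀ s, (ν.restrict (Iic t)).real (Iic s) = ν.real (Iic s ∩ Iic t) := fun s =>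
    measureReal_restrict_apply measurableSet_Iic
  have huniv : (ν.restrict (Iic t)).real univ = ν.real (Iic t) := by simp [Measure.real]
  have h1 : ∫ s in Iic t, ν.real (Iic s) ^ n ∂ν
      = ∫ s, (fun x : ℝ => x ^ n) ((ν.restrict (Iic t)).real (Iic s)) ∂(ν.restrict (Iic t)) := by
    refine setIntegral_congr_fun measurableSet_Iic fun s hs => ?_
    simp only [hμ, Iic_inter_Iic, inf_eq_left.2 (mem_Iic.1 hs)]
  have hle : (ν.restrict (Iic t)).real (Iic a) = 0 :=
    le_antisymm (by rw [hμ, ← ha]; exact measureReal_mono inter_subset_left) measureReal_nonneg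
  have hall : (ν.restrict (Iic t)).real (Iic t) = (ν.restrict (Iic t)).real univ := by
    rw [hμ, huniv, inter_self]
  have hmap := map_measureReal_Iic (ν.restrict (Iic t)) hle hall
  rw [h1, ← integral_map (continuous_measureReal_Iic _).aemeasurable
    (continuous_pow n).aestronglyMeasurable, hmap, huniv,
    integral_Icc_eq_integral_Ioc, ← intervalIntegral.integral_of_le measureReal_nonneg,
    integral_pow]
  simp

end Distribution

end Magnus

/-! ### The Volterra equation of the time-ordered exponential. -/

namespace Magnus

/-- The distribution function of the variation of `φ` on `[a, b]`. -/
noncomputable def cumVar {𝔄 : Type*} [NormedRing 𝔄] (φ : VectorMeasure ℝ 𝔄) (a b t : ℝ) : ℝ :=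
  (φ.variation.restrict (Icc a b)).real (Iic t)

section Volterra

variable {𝔄 : Type*} [NormedRing 𝔄] {φ : VectorMeasure ℝ 𝔄} {a b : ℝ}

theorem isFiniteMeasure_variation_restrict (hfin : φ.variation (Icc a b) ≠ ∞) :
    IsFiniteMeasure (φ.variation.restrict (Icc a b)) :=
  ⟨by simpa using hfin.lt_top⟩

theorem nullSingletonClass_variation_restrict (hat : ∀ x ∈ Icc a b, φ {x} = 0) :
    NullSingletonClass (φ.variation.restrict (Icc a b)) := by
  refine ⟨fun x => ?_⟩
  rw [Measure.restrict_apply (measurableSet_singleton x)]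
  by_cases hx : x ∈ Icc a b
  · rw [singleton_inter_of_mem hx, VectorMeasure.variation_apply_eq_zero (measurableSet_singleton x)]
    intro t ht _
    rcases subset_singleton_iff_eq.1 ht with rfl | rfl
    · simp
    · exact hat x hx
  · rw [singleton_inter_eq_empty.2 hx, measure_empty]

theorem monotone_cumVar (hfin : φ.variation (Icc a b) ≠ ∞) : Monotone (cumVar φ a b) :=
  have := isFiniteMeasure_variation_restrict hfin
  monotone_measureReal_Iic _

theorem continuous_cumVar (hfin : φ.variation (Icc a b) ≠ ∞) (hat : ∀ x ∈ Icc a b, φ {x} = 0) :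
    Continuous (cumVar φ a b) :=
  have := isFiniteMeasure_variation_restrict hfin
  have := nullSingletonClass_variation_restrict hat
  continuous_measureReal_Iic _

theorem cumVar_nonneg (t : ℝ) : 0 ≤ cumVar φ a b t := measureReal_nonneg

theorem cumVar_left (hat : ∀ x ∈ Icc a b, φ {x} = 0) : cumVar φ a b a = 0 := by
  have := nullSingletonClass_variation_restrict hat
  have h : Iic a ∩ Icc a b ⊆ {a} := fun x hx => le_antisymm hx.1 hx.2.1
  have h2 : (φ.variation.restrict (Icc a b)) (Iic a) = 0 := by
    rw [Measure.restrict_apply measurableSet_Iic]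
    refine measure_mono_null (t := {a} ∩ Icc a b) (subset_inter h inter_subset_right) ?_
    rw [← Measure.restrict_apply (measurableSet_singleton a)]
    exact measure_singleton a
  simp [cumVar, Measure.real, h2]

theorem cumVar_right : cumVar φ a b b = (φ.variation (Icc a b)).toReal := by
  have h : Iic b ∩ Icc a b = Icc a b := inter_eq_right.2 fun x hx => hx.2
  rw [cumVar, measureReal_restrict_apply measurableSet_Iic, h, Measure.real]

theorem variation_real_Ioc (hfin : φ.variation (Icc a b) ≠ ∞) {s t : ℝ} (hs : s ∈ Icc a b)
    (ht : t ∈ Icc a b) (hst : s ≤ t) :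
    φ.variation.real (Ioc s t) = cumVar φ a b t - cumVar φ a b s := by
  have := isFiniteMeasure_variation_restrict hfin
  have h : Ioc s t ∩ Icc a b = Ioc s t :=
    inter_eq_left.2 fun x hx => ⟨hs.1.trans hx.1.le, hx.2.trans ht.2⟩
  rw [cumVar, cumVar, ← measureReal_sdiff (Iic_subset_Iic.2 hst) measurableSet_Iic, Iic_sdiff_Iic,
    measureReal_restrict_apply measurableSet_Ioc, h]

theorem integrableOn_of_continuousOn (hfin : φ.variation (Icc a b) ≠ ∞) {f : ℝ → 𝔄}
    (hf : ContinuousOn f (Icc a b)) {s : Set ℝ} (hs : s ⊆ Icc a b) : φ.IntegrableOn f s := by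
  refine VectorMeasure.IntegrableOn.mono measurableSet_Icc hs ?_
  obtain ⟨C, hC⟩ := isCompact_Icc.exists_bound_of_continuousOn hf
  have := isFiniteMeasure_variation_restrict hfin
  have h : IntegrableOn f (Icc a b) φ.variation :=
    Integrable.of_bound (hf.aestronglyMeasurable measurableSet_Icc) C
      ((ae_restrict_iff' measurableSet_Icc).2 (Filter.Eventually.of_forall hC))
  unfold VectorMeasure.IntegrableOn VectorMeasure.Integrable
  rwa [VectorMeasure.variation_restrict measurableSet_Icc]

variable [NormedAlgebra ℝ 𝔄]

/-- The integral of `φ(s) f(s)` over a set, with the measure as the left factor. -/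
noncomputable abbrev leftIntegral (φ : VectorMeasure ℝ 𝔄) (s : Set ℝ) (f : ℝ → 𝔄) : 𝔄 :=
  VectorMeasure.integral (φ.restrict s) f (ContinuousLinearMap.mul ℝ 𝔄).flip

theorem leftIntegral_Icc_sub (hfin : φ.variation (Icc a b) ≠ ∞) {f : ℝ → 𝔄}
    (hf : ContinuousOn f (Icc a b)) {s t : ℝ} (hs : s ∈ Icc a b) (ht : t ∈ Icc a b)
    (hst : s ≤ t) :
    leftIntegral φ (Icc a t) f - leftIntegral φ (Icc a s) f = leftIntegral φ (Ioc s t) f := by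
  rw [leftIntegral, leftIntegral, leftIntegral, ← VectorMeasure.setIntegral_sdiff measurableSet_Icc
    measurableSet_Icc (integrableOn_of_continuousOn hfin hf (Icc_subset_Icc_right ht.2))
    (Icc_subset_Icc_right hst)]
  congr 2
  ext x
  simp only [mem_sdiff, mem_Icc, mem_Ioc, not_and, not_le]
  exact ⟨fun h => ⟨h.2 h.1.1, h.1.2⟩, fun h => ⟨⟨hs.1.trans h.1.le, h.2⟩, fun _ => h.1⟩⟩

theorem norm_mul_flip_le : ‖(ContinuousLinearMap.mul ℝ 𝔄).flip‖ ≤ 1 := by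
  rw [ContinuousLinearMap.opNorm_flip]
  exact ContinuousLinearMap.opNorm_mul_le ℝ 𝔄

theorem norm_leftIntegral_le {s : Set ℝ} (hs : MeasurableSet s) (f : ℝ → 𝔄) :
    ‖leftIntegral φ s f‖ ≤ ∫ x in s, ‖f x‖ ∂φ.variation := by
  refine (VectorMeasure.norm_integral_le_integral_norm).trans ?_
  rw [VectorMeasure.variation_restrict hs]
  exact mul_le_of_le_one_left (integral_nonneg fun _ => norm_nonneg _) norm_mul_flip_le

theorem norm_leftIntegral_Ioc_le (hfin : φ.variation (Icc a b) ≠ ∞) {f : ℝ → 𝔄} {C : ℝ}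
    {s t : ℝ} (hs : s ∈ Icc a b) (ht : t ∈ Icc a b) (hst : s ≤ t) (hC : ∀ x ∈ Ioc s t, ‖f x‖ ≤ C) :
    ‖leftIntegral φ (Ioc s t) f‖ ≤ C * (cumVar φ a b t - cumVar φ a b s) := by
  rw [← variation_real_Ioc hfin hs ht hst]
  have hsub : Ioc s t ⊆ Icc a b := fun x hx => ⟨hs.1.trans hx.1.le, hx.2.trans ht.2⟩
  have hfin' : φ.variation (Ioc s t) < ∞ := (measure_mono hsub).trans_lt hfin.lt_top
  refine (norm_leftIntegral_le measurableSet_Ioc f).trans ?_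
  refine (Real.le_norm_self _).trans (norm_setIntegral_le_of_norm_le_const hfin' ?_)
  simpa using hC

theorem continuousOn_leftIntegral (hfin : φ.variation (Icc a b) ≠ ∞)
    (hat : ∀ x ∈ Icc a b, φ {x} = 0) {f : ℝ → 𝔄} (hf : ContinuousOn f (Icc a b)) :
    ContinuousOn (fun t => leftIntegral φ (Icc a t) f) (Icc a b) := by
  obtain ⟨C, hC⟩ := isCompact_Icc.exists_bound_of_continuousOn hf
  have key : ∀ s ∈ Icc a b, ∀ t ∈ Icc a b, s ≤ t →
      ‖leftIntegral φ (Icc a t) f - leftIntegral φ (Icc a s) f‖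
        ≤ C * |cumVar φ a b t - cumVar φ a b s| := by
    intro s hs t ht hst
    rw [leftIntegral_Icc_sub hfin hf hs ht hst,
      abs_of_nonneg (sub_nonneg.2 (monotone_cumVar hfin hst))]
    exact norm_leftIntegral_Ioc_le hfin hs ht hst fun x hx =>
      hC x ⟨hs.1.trans hx.1.le, hx.2.trans ht.2⟩
  intro s hs
  rw [ContinuousWithinAt, tendsto_iff_norm_sub_tendsto_zero]
  have hlim : Filter.Tendsto (fun t => C * |cumVar φ a b t - cumVar φ a b s|)
      (nhdsWithin s (Icc a b)) (nhds 0) := by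
    have hc : Continuous fun t => C * |cumVar φ a b t - cumVar φ a b s| :=
      continuous_const.mul ((continuous_cumVar hfin hat).sub continuous_const).abs
    have := (hc.tendsto s).mono_left (nhdsWithin_le_nhds (s := Icc a b))
    simpa using this
  refine squeeze_zero' (Filter.Eventually.of_forall fun _ => norm_nonneg _) ?_ hlim
  filter_upwards [self_mem_nhdsWithin] with t ht
  rcases le_total s t with hst | hst
  · exact key s hs t ht hst
  · rw [norm_sub_rev, abs_sub_comm]
    exact key t ht s hs hst

theorem norm_leftIntegral_le_of_pow (hfin : φ.variation (Icc a b) ≠ ∞)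
    (hat : ∀ x ∈ Icc a b, φ {x} = 0) {f : ℝ → 𝔄} {M : ℝ} {n : ℕ}
    (hM : ∀ t ∈ Icc a b, ‖f t‖ ≤ M * (cumVar φ a b t ^ n / n.factorial)) {t : ℝ}
    (ht : t ∈ Icc a b) :
    ‖leftIntegral φ (Icc a t) f‖ ≤ M * (cumVar φ a b t ^ (n + 1) / (n + 1).factorial) := by
  have := isFiniteMeasure_variation_restrict hfin
  have := nullSingletonClass_variation_restrict hat
  have hset : Iic t ∩ Icc a b = Icc a t := by
    ext x
    simp only [mem_inter_iff, mem_Iic, mem_Icc]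
    exact ⟨fun h => ⟨h.2.1, h.1⟩, fun h => ⟨h.2, h.1, h.2.trans ht.2⟩⟩
  have hres : φ.variation.restrict (Icc a t) =
      (φ.variation.restrict (Icc a b)).restrict (Iic t) := by
    rw [Measure.restrict_restrict measurableSet_Iic, hset]
  have hint : IntegrableOn (fun s => M * (cumVar φ a b s ^ n / n.factorial)) (Icc a t)
      φ.variation := by
    have hc : Continuous fun s => M * (cumVar φ a b s ^ n / n.factorial) :=
      continuous_const.mul (((continuous_cumVar hfin hat).pow n).div_const _)
    obtain ⟨C, hC⟩ := isCompact_Icc.exists_bound_of_continuousOn (s := Icc a t) hc.continuousOn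
    exact Measure.integrableOn_of_bounded
      ((measure_mono (Icc_subset_Icc_right ht.2)).trans_lt hfin.lt_top).ne
      hc.aestronglyMeasurable
      ((ae_restrict_iff' measurableSet_Icc).2 (Filter.Eventually.of_forall hC))
  calc ‖leftIntegral φ (Icc a t) f‖ ≤ ∫ x in Icc a t, ‖f x‖ ∂φ.variation :=
        norm_leftIntegral_le measurableSet_Icc f
    _ ≤ ∫ s in Icc a t, M * (cumVar φ a b s ^ n / n.factorial) ∂φ.variation := by
        refine integral_mono_of_nonneg (Filter.Eventually.of_forall fun _ => norm_nonneg _) hint ?_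
        exact (ae_restrict_iff' measurableSet_Icc).2
          (Filter.Eventually.of_forall fun s hs => hM s ⟨hs.1, hs.2.trans ht.2⟩)
    _ = M * ((∫ s in Iic t, cumVar φ a b s ^ n ∂(φ.variation.restrict (Icc a b)))
          / n.factorial) := by
        rw [integral_const_mul, integral_div, hres]
    _ = M * (cumVar φ a b t ^ (n + 1) / (n + 1).factorial) := by
        have h := integral_measureReal_Iic_pow (φ.variation.restrict (Icc a b))
          (cumVar_left hat) t n
        unfold cumVar
        rw [h, Nat.factorial_succ]
        push_cast
        rw [div_div]

/-- Iterating the Volterra operator of `φ` gives factorially decaying functions. -/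
theorem norm_iterate_leftIntegral_le (hfin : φ.variation (Icc a b) ≠ ∞)
    (hat : ∀ x ∈ Icc a b, φ {x} = 0) {F : ℕ → ℝ → 𝔄} {M : ℝ}
    (h0 : ∀ t ∈ Icc a b, ‖F 0 t‖ ≤ M)
    (hsucc : ∀ n, ∀ t ∈ Icc a b, F (n + 1) t = leftIntegral φ (Icc a t) (F n)) (n : ℕ) :
    ∀ t ∈ Icc a b, ‖F n t‖ ≤ M * (cumVar φ a b t ^ n / n.factorial) := by
  induction n with
  | zero => simpa using h0
  | succ n ih =>
    intro t ht
    rw [hsucc n t ht]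
    exact norm_leftIntegral_le_of_pow hfin hat ih ht

theorem lexpTerm_succ (n : ℕ) (t : ℝ) :
    lexpTerm φ a (n + 1) t = leftIntegral φ (Icc a t) (lexpTerm φ a n) := rfl

theorem continuousOn_lexpTerm (hfin : φ.variation (Icc a b) ≠ ∞)
    (hat : ∀ x ∈ Icc a b, φ {x} = 0) (n : ℕ) : ContinuousOn (lexpTerm φ a n) (Icc a b) := by
  induction n with
  | zero => exact continuousOn_const
  | succ n ih => exact continuousOn_leftIntegral hfin hat ih

theorem norm_lexpTerm_le (hfin : φ.variation (Icc a b) ≠ ∞)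
    (hat : ∀ x ∈ Icc a b, φ {x} = 0) (n : ℕ) {t : ℝ} (ht : t ∈ Icc a b) :
    ‖lexpTerm φ a n t‖ ≤ ‖(1 : 𝔄)‖ * (cumVar φ a b b ^ n / n.factorial) := by
  refine (norm_iterate_leftIntegral_le hfin hat (M := ‖(1 : 𝔄)‖) (fun _ _ => le_rfl)
    (fun n t _ => lexpTerm_succ n t) n t ht).trans ?_
  have := monotone_cumVar hfin ht.2
  have := cumVar_nonneg (φ := φ) (a := a) (b := b) t
  gcongr

variable [CompleteSpace 𝔄]

theorem summable_lexpTerm (hfin : φ.variation (Icc a b) ≠ ∞)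
    (hat : ∀ x ∈ Icc a b, φ {x} = 0) {t : ℝ} (ht : t ∈ Icc a b) :
    Summable fun n => lexpTerm φ a n t :=
  Summable.of_norm_bounded ((Real.summable_pow_div_factorial _).mul_left _)
    fun n => norm_lexpTerm_le hfin hat n ht

theorem continuousOn_lexp (hfin : φ.variation (Icc a b) ≠ ∞)
    (hat : ∀ x ∈ Icc a b, φ {x} = 0) : ContinuousOn (lexp φ a) (Icc a b) :=
  continuousOn_tsum (continuousOn_lexpTerm hfin hat)
    ((Real.summable_pow_div_factorial (cumVar φ a b b)).mul_left ‖(1 : 𝔄)‖)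
    fun n _ ht => norm_lexpTerm_le hfin hat n ht

/-- The time-ordered exponential solves the Volterra equation of `φ`. -/
theorem lexp_eq_one_add_leftIntegral (hfin : φ.variation (Icc a b) ≠ ∞)
    (hat : ∀ x ∈ Icc a b, φ {x} = 0) {t : ℝ} (ht : t ∈ Icc a b) :
    lexp φ a t = 1 + leftIntegral φ (Icc a t) (lexp φ a) := by
  have hsub : Icc a t ⊆ Icc a b := Icc_subset_Icc_right ht.2
  have hvar : (φ.restrict (Icc a t)).variation = φ.variation.restrict (Icc a t) :=
    VectorMeasure.variation_restrict measurableSet_Icc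
  have hfin' : φ.variation (Icc a t) ≠ ∞ := ((measure_mono hsub).trans_lt hfin.lt_top).ne
  have : IsFiniteMeasure (φ.variation.restrict (Icc a t)) := ⟨by simpa using hfin'.lt_top⟩
  have hae : ∀ {p : ℝ → Prop}, (∀ s ∈ Icc a b, p s) →
      ∀ᵐ s ∂(φ.restrict (Icc a t)).variation, p s := by
    intro p hp
    rw [hvar]
    exact (ae_restrict_iff' measurableSet_Icc).2
      (Filter.Eventually.of_forall fun s hs => hp s (hsub hs))
  have hS := (Real.summable_pow_div_factorial (cumVar φ a b b)).mul_left ‖(1 : 𝔄)‖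
  have hsum : HasSum (fun n => leftIntegral φ (Icc a t) (lexpTerm φ a n))
      (leftIntegral φ (Icc a t) (lexp φ a)) := by
    refine VectorMeasure.hasSum_integral_of_dominated_convergence
      (fun n _ => ‖(1 : 𝔄)‖ * (cumVar φ a b b ^ n / n.factorial)) (fun n => ?_) (fun n => ?_) ?_ ?_ ?_
    · rw [hvar]
      exact ((continuousOn_lexpTerm hfin hat n).mono hsub).aestronglyMeasurable measurableSet_Icc
    · exact hae fun s hs => norm_lexpTerm_le hfin hat n hs
    · exact hae fun s hs => hS
    · rw [hvar]
      exact integrable_const _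
    · exact hae fun s hs => (summable_lexpTerm hfin hat hs).hasSum
  rw [lexp, (summable_lexpTerm hfin hat ht).tsum_eq_zero_add, ← hsum.tsum_eq]
  rfl

/-- Continuous solutions of the Volterra equation of `φ` are unique. -/
theorem eq_lexp_of_eq_one_add_leftIntegral (hfin : φ.variation (Icc a b) ≠ ∞)
    (hat : ∀ x ∈ Icc a b, φ {x} = 0) {U : ℝ → 𝔄} (hU : ContinuousOn U (Icc a b))
    (hUeq : ∀ t ∈ Icc a b, U t = 1 + leftIntegral φ (Icc a t) U) {t : ℝ} (ht : t ∈ Icc a b) :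
    lexp φ a t = U t := by
  have hD : ContinuousOn (fun s => U s - lexp φ a s) (Icc a b) := hU.sub (continuousOn_lexp hfin hat)
  obtain ⟨C, hC⟩ := isCompact_Icc.exists_bound_of_continuousOn hD
  have hDeq : ∀ t ∈ Icc a b, U t - lexp φ a t
      = leftIntegral φ (Icc a t) (fun s => U s - lexp φ a s) := by
    intro t ht
    have hsub : Icc a t ⊆ Icc a b := Icc_subset_Icc_right ht.2
    have hi := VectorMeasure.integral_fun_sub (B := (ContinuousLinearMap.mul ℝ 𝔄).flip)
      (integrableOn_of_continuousOn hfin hU hsub)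
      (integrableOn_of_continuousOn hfin (continuousOn_lexp hfin hat) hsub)
    rw [leftIntegral, hi, hUeq t ht, lexp_eq_one_add_leftIntegral hfin hat ht]
    exact add_sub_add_left_eq_sub _ _ _
  -- The difference is a fixed point of the Volterra operator, so the constant sequence is its own
  -- sequence of iterates and obeys the factorial bound for every `n`.
  have hb := norm_iterate_leftIntegral_le hfin hat (F := fun _ s => U s - lexp φ a s) hC
    fun _ t ht => hDeq t ht
  have hlim : Filter.Tendsto (fun n : ℕ => C * (cumVar φ a b t ^ n / n.factorial)) Filter.atTop
      (nhds 0) := by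
    simpa using (FloorSemiring.tendsto_pow_div_factorial_atTop (cumVar φ a b t)).const_mul C
  have h0 : ‖U t - lexp φ a t‖ ≤ 0 := ge_of_tendsto' hlim fun n => hb n t ht
  exact (sub_eq_zero.1 (norm_le_zero_iff.1 h0)).symm

end Volterra

end Magnus

/-! ### Transported vectors and the lower bound by logarithms. -/

namespace Magnus

section Action

variable {𝔄 : Type*} [NormedRing 𝔄] [NormedAlgebra ℝ 𝔄] [CompleteSpace 𝔄]
  {X : Type*} [NormedAddCommGroup X] [NormedSpace ℝ X] [CompleteSpace X]
  {φ : VectorMeasure ℝ 𝔄} {a b : ℝ} {ρ : 𝔄 →ₗ[ℝ] X →ₗ[ℝ] X}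

/-- Evaluation at `v` is moved inside the vector integral, so only the size of `ρ (f r) v` enters
and not the norm of `f r`. This is what lets the increment be compared with the current vector
itself. -/
theorem norm_action_leftIntegral_Ioc_le (hρm : ∀ A B v, ρ (A * B) v = ρ A (ρ B v))
    (hρ : ∀ A v, ‖ρ A v‖ ≤ ‖A‖ * ‖v‖) (hfin : φ.variation (Icc a b) ≠ ∞)
    {f : ℝ → 𝔄} (hf : ContinuousOn f (Icc a b)) {s t : ℝ} (hs : s ∈ Icc a b) (ht : t ∈ Icc a b)
    (hst : s ≤ t) (v : X) {C : ℝ} (hC : ∀ r ∈ Icc s t, ‖ρ (f r) v‖ ≤ C) :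
    ‖ρ (leftIntegral φ (Ioc s t) f) v‖ ≤ C * (cumVar φ a b t - cumVar φ a b s) := by
  have hsub : Ioc s t ⊆ Icc a b := fun x hx => ⟨hs.1.trans hx.1.le, hx.2.trans ht.2⟩
  have hC0 : 0 ≤ C := (norm_nonneg _).trans (hC s ⟨le_rfl, hst⟩)
  have : IsFiniteMeasure (φ.variation.restrict (Ioc s t)) :=
    ⟨by simpa using (measure_mono hsub).trans_lt hfin.lt_top⟩
  let T : X →L[ℝ] 𝔄 →L[ℝ] X := LinearMap.mkContinuous₂ ρ.flip 1 fun v A => by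
    simpa [mul_comm] using hρ A v
  have hT : ‖T‖ ≤ 1 := LinearMap.mkContinuous₂_norm_le _ zero_le_one _
  have hTa : ∀ v A, T v A = ρ A v := fun v A => rfl
  have hi := integrableOn_of_continuousOn hfin hf hsub
  have h1 := VectorMeasure.continuousLinearMap_apply_integral
    (B := (ContinuousLinearMap.mul ℝ 𝔄).flip) (C := T v) hi
  have h2 := VectorMeasure.integral_continuousLinearMap_comp (B := T) (C := T v) hi
  have h3 : (ContinuousLinearMap.compL ℝ 𝔄 𝔄 X (T v)).comp (ContinuousLinearMap.mul ℝ 𝔄).flip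
      = T.comp (T v) := by
    ext Y A
    simp [hTa, hρm]
  have h4 : ρ (leftIntegral φ (Ioc s t) f) v
      = VectorMeasure.integral (φ.restrict (Ioc s t)) (fun r => T v (f r)) T := by
    rw [h2, ← h3, ← h1, hTa]
  rw [h4, ← variation_real_Ioc hfin hs ht hst]
  refine (VectorMeasure.norm_setIntegral_le_of_norm_le_const
    fun x hx => hC x ⟨hx.1.le, hx.2⟩).trans ?_
  have := mul_le_of_le_one_right hC0 hT
  gcongr

omit [CompleteSpace X] in
theorem continuousOn_action_lexp (hρ : ∀ A v, ‖ρ A v‖ ≤ ‖A‖ * ‖v‖)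
    (hfin : φ.variation (Icc a b) ≠ ∞) (hat : ∀ x ∈ Icc a b, φ {x} = 0) (v : X) :
    ContinuousOn (fun t => ρ (lexp φ a t) v) (Icc a b) :=
  ((ρ.flip v).mkContinuous ‖v‖ fun A => by
    simpa [mul_comm] using hρ A v).continuous.comp_continuousOn (continuousOn_lexp hfin hat)

/-- A solution of the Volterra equation varies by at most a multiple of its initial size. -/
theorem norm_action_lexp_sub_le (hρm : ∀ A B v, ρ (A * B) v = ρ A (ρ B v))
    (hρ : ∀ A v, ‖ρ A v‖ ≤ ‖A‖ * ‖v‖) (hfin : φ.variation (Icc a b) ≠ ∞)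
    (hat : ∀ x ∈ Icc a b, φ {x} = 0) {s t : ℝ} (hs : s ∈ Icc a b) (ht : t ∈ Icc a b)
    (hst : s ≤ t) (v : X) (hlt : cumVar φ a b t - cumVar φ a b s < 1) :
    ‖ρ (lexp φ a t) v - ρ (lexp φ a s) v‖ ≤ (cumVar φ a b t - cumVar φ a b s) /
      (1 - (cumVar φ a b t - cumVar φ a b s)) * ‖ρ (lexp φ a s) v‖ := by
  have hcont := continuousOn_lexp hfin hat
  have hsubI : Icc s t ⊆ Icc a b := Icc_subset_Icc hs.1 ht.2
  set u : ℝ → X := fun t => ρ (lexp φ a t) v with hu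
  have hinc : ∀ r ∈ Icc s t, ∀ C, (∀ x ∈ Icc s t, ‖u x‖ ≤ C) →
      ‖u r - u s‖ ≤ C * (cumVar φ a b t - cumVar φ a b s) := by
    intro r hr C hC
    have hr' := hsubI hr
    have hC0 : 0 ≤ C := (norm_nonneg _).trans (hC s ⟨le_rfl, hst⟩)
    have hlin : u r - u s = ρ (lexp φ a r - lexp φ a s) v := by simp [hu]
    rw [hlin, lexp_eq_one_add_leftIntegral hfin hat hr', lexp_eq_one_add_leftIntegral hfin hat hs,
      add_sub_add_left_eq_sub, leftIntegral_Icc_sub hfin hcont hs hr' hr.1]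
    refine (norm_action_leftIntegral_Ioc_le hρm hρ hfin hcont hs hr' hr.1 v
      fun x hx => hC x ⟨hx.1, hx.2.trans hr.2⟩).trans ?_
    have := monotone_cumVar hfin hr.2
    gcongr
  set δ := cumVar φ a b t - cumVar φ a b s
  have hδ : 0 ≤ δ := sub_nonneg.2 (monotone_cumVar hfin hst)
  -- At a maximum point `r` of `‖u‖` the increment bound reads `‖u r‖ ≤ ‖u s‖ + δ ‖u r‖`, which can
  -- be solved for `‖u r‖`.
  obtain ⟨r, hr, hmax⟩ := isCompact_Icc.exists_isMaxOn (nonempty_Icc.2 hst)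
    (((continuousOn_action_lexp hρ hfin hat v).mono hsubI).norm)
  have hmax' : ∀ x ∈ Icc s t, ‖u x‖ ≤ ‖u r‖ := fun x hx => hmax hx
  have h1 := hinc r hr _ hmax'
  have h2 : ‖u r‖ ≤ ‖u s‖ + ‖u r - u s‖ := by
    simpa using norm_add_le (u s) (u r - u s)
  have h3 : ‖u r‖ ≤ ‖u s‖ / (1 - δ) := by
    rw [le_div_iff₀ (by linarith)]
    linarith
  refine (hinc t ⟨hst, le_rfl⟩ _ hmax').trans ?_
  calc ‖u r‖ * δ ≤ ‖u s‖ / (1 - δ) * δ := by gcongr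
    _ = δ / (1 - δ) * ‖u s‖ := by ring

end Action

/-- Only the leading coefficient 1 matters; the quadratic error vanishes under refinement. Passing
from `δ / (1 - δ)` to `δ` and from the logarithm to `z` costs at most `4 / 3 * δ ^ 2` each, together
less than `3 * δ ^ 2`. -/
theorem norm_log_one_add_le_of_le_div {δ : ℝ} (hδ : 0 ≤ δ) (hδ' : δ ≤ 1 / 4) {z : ℂ}
    (hz : ‖z‖ ≤ δ / (1 - δ)) : ‖Complex.log (1 + z)‖ ≤ δ * (1 + 3 * δ) := by
  have hd : δ / (1 - δ) ≤ δ * (1 + 4 / 3 * δ) := by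
    rw [div_le_iff₀ (by linarith)]
    nlinarith [mul_nonneg hδ hδ]
  have hz1 : ‖z‖ ≤ δ * (1 + 4 / 3 * δ) := hz.trans hd
  have hz2 : ‖z‖ ≤ 4 / 3 * δ := hz1.trans (by nlinarith)
  have hz3 : ‖z‖ ≤ 1 / 3 := by linarith
  have hinv : (1 - ‖z‖)⁻¹ ≤ 3 / 2 := by
    rw [inv_le_comm₀ (by linarith) (by norm_num)]
    linarith
  have hsq : ‖z‖ ^ 2 ≤ (4 / 3 * δ) ^ 2 := by gcongr
  calc ‖Complex.log (1 + z)‖ ≤ ‖z‖ ^ 2 * (1 - ‖z‖)⁻¹ / 2 + ‖z‖ :=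
        Complex.norm_log_one_add_le (by linarith)
    _ ≤ (4 / 3 * δ) ^ 2 * (3 / 2) / 2 + δ * (1 + 4 / 3 * δ) := by
        have : 0 ≤ (1 - ‖z‖)⁻¹ := inv_nonneg.2 (by linarith)
        gcongr
    _ ≤ δ * (1 + 3 * δ) := by nlinarith [mul_nonneg hδ hδ]

/-- The principal logarithm has the smallest norm among all logarithms. -/
theorem norm_log_exp_le (w : ℂ) : ‖Complex.log (Complex.exp w)‖ ≤ ‖w‖ := by
  obtain ⟨n, hn⟩ : ∃ n : ℤ, w = Complex.log (Complex.exp w) + n * (2 * Real.pi * Complex.I) :=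
    Complex.exp_eq_exp_iff_exists_int.1 (Complex.exp_log (Complex.exp_ne_zero w)).symm
  set l := Complex.log (Complex.exp w)
  have hre : w.re = l.re := by rw [hn]; simp
  have him : w.im = l.im + n * (2 * Real.pi) := by
    have := congrArg Complex.im hn
    simpa using this
  have h1 : |l.im| ≤ Real.pi := by
    rw [Complex.log_im]
    exact Complex.abs_arg_le_pi _
  have h2 : |l.im| ≤ |w.im| := by
    rcases eq_or_ne n 0 with rfl | hn0
    · simp [him]
    · have hn1 : (1 : ℝ) ≤ |(n : ℝ)| := by exact_mod_cast Int.one_le_abs hn0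
      have h3 : |(n : ℝ) * (2 * Real.pi)| ≤ |w.im| + |l.im| := by
        rw [show (n : ℝ) * (2 * Real.pi) = w.im - l.im by linarith]
        exact abs_sub _ _
      rw [abs_mul, abs_of_pos Real.two_pi_pos] at h3
      nlinarith [Real.pi_pos]
  rw [← sq_le_sq₀ (norm_nonneg _) (norm_nonneg _), Complex.sq_norm, Complex.sq_norm,
    Complex.normSq_apply, Complex.normSq_apply, hre]
  have := sq_le_sq.2 h2
  nlinarith

section LowerBound

variable {𝔄 : Type*} [NormedRing 𝔄] [NormedAlgebra ℝ 𝔄] [CompleteSpace 𝔄]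
  {φ : VectorMeasure ℝ 𝔄} {a b : ℝ} {ρ : 𝔄 →ₗ[ℝ] ℂ →ₗ[ℝ] ℂ}

theorem lexp_left (hat : ∀ x ∈ Icc a b, φ {x} = 0) (hab : a ≤ b)
    (hfin : φ.variation (Icc a b) ≠ ∞) : lexp φ a a = 1 := by
  have h := lexp_eq_one_add_leftIntegral hfin hat (left_mem_Icc.2 hab)
  have h2 := norm_leftIntegral_le (φ := φ) (measurableSet_Icc (a := a) (b := a)) (lexp φ a)
  have h3 : φ.variation.restrict (Icc a a) = 0 := by
    rw [Icc_self, Measure.restrict_eq_zero,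
      VectorMeasure.variation_apply_eq_zero (measurableSet_singleton a)]
    intro t ht _
    rcases subset_singleton_iff_eq.1 ht with rfl | rfl
    · simp
    · exact hat a (left_mem_Icc.2 hab)
  rw [h3, integral_zero_measure] at h2
  rw [h, norm_le_zero_iff.1 h2, add_zero]

/-- On a fine partition each ratio of consecutive vectors is close to 1, so its principal logarithm
is small and additive errors are controlled. The sum `w` is the logarithm continued along the path,
so no branch cut interferes even if it is not principal. -/
theorem exists_log_action_lexp (hρ1 : ∀ v, ρ 1 v = v)
    (hρm : ∀ A B v, ρ (A * B) v = ρ A (ρ B v))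
    (hρ : ∀ A v, ‖ρ A v‖ ≤ ‖A‖ * ‖v‖) (hfin : φ.variation (Icc a b) ≠ ∞)
    (hat : ∀ x ∈ Icc a b, φ {x} = 0) (hab : a ≤ b) {v : ℂ} (hv : v ≠ 0) {ε : ℝ} (hε : 0 < ε)
    (hε' : ε ≤ 1 / 4) :
    ∃ w : ℂ, ρ (lexp φ a b) v = Complex.exp w * v ∧
      ‖w‖ ≤ cumVar φ a b b * (1 + 3 * ε) := by
  obtain ⟨d, hd, huc⟩ := Metric.uniformContinuousOn_iff.1
    (isCompact_Icc.uniformContinuousOn_of_continuous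
      (continuous_cumVar hfin hat).continuousOn (s := Icc a b)) ε hε
  -- Grid points are clamped at `b`; the mesh `d / 2` keeps neighbours strictly closer than the
  -- modulus `d` of uniform continuity.
  have key : ∀ n : ℕ, ∃ w : ℂ, ρ (lexp φ a (min b (a + n * (d / 2)))) v = Complex.exp w * v ∧
      ‖w‖ ≤ cumVar φ a b (min b (a + n * (d / 2))) * (1 + 3 * ε) := by
    intro n
    induction n with
    | zero =>
      refine ⟨0, ?_, ?_⟩
      · simp [hab, lexp_left hat hab hfin, hρ1]
      · simp [hab, cumVar_left hat]
    | succ n ih =>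
      obtain ⟨w, hw, hwn⟩ := ih
      set s := min b (a + n * (d / 2)) with hs
      set t := min b (a + ((n + 1 : ℕ) : ℝ) * (d / 2)) with ht
      have hn : (0 : ℝ) ≤ n * (d / 2) := by positivity
      have hle : a + n * (d / 2) ≤ a + ((n + 1 : ℕ) : ℝ) * (d / 2) := by
        push_cast
        linarith
      have hsI : s ∈ Icc a b := ⟨le_min hab (by linarith), min_le_left _ _⟩
      have htI : t ∈ Icc a b := ⟨le_min hab (by linarith), min_le_left _ _⟩
      have hst : s ≤ t := min_le_min_left b hle
      have hdist : dist t s < d := by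
        rw [Real.dist_eq, abs_of_nonneg (sub_nonneg.2 hst)]
        have h1 : t ≤ s + d / 2 := by
          rw [hs, ← min_add_add_right]
          exact le_min ((min_le_left _ _).trans (by linarith))
            ((min_le_right _ _).trans (by push_cast; linarith))
        linarith
      have hδε := huc t htI s hsI hdist
      rw [Real.dist_eq, abs_of_nonneg (sub_nonneg.2 (monotone_cumVar hfin hst))] at hδε
      have hδ0 : 0 ≤ cumVar φ a b t - cumVar φ a b s := sub_nonneg.2 (monotone_cumVar hfin hst)
      have hstep := norm_action_lexp_sub_le hρm hρ hfin hat hsI htI hst v (by linarith)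
      set δ := cumVar φ a b t - cumVar φ a b s with hδ
      have hu0 : ρ (lexp φ a s) v ≠ 0 := by
        rw [hw]
        exact mul_ne_zero (Complex.exp_ne_zero w) hv
      set z := (ρ (lexp φ a t) v - ρ (lexp φ a s) v) / ρ (lexp φ a s) v with hz
      have hzn : ‖z‖ ≤ δ / (1 - δ) := by
        rw [hz, norm_div, div_le_iff₀ (norm_pos_iff.2 hu0)]
        exact hstep
      have hlog := norm_log_one_add_le_of_le_div hδ0 (by linarith) hzn
      have hz1 : ‖z‖ < 1 := by
        refine hzn.trans_lt ?_
        rw [div_lt_one (by linarith)]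
        linarith
      have h1z : 1 + z ≠ 0 := by
        intro h
        have : z = -1 := by linear_combination h
        rw [this] at hz1
        simp at hz1
      refine ⟨w + Complex.log (1 + z), ?_, ?_⟩
      · rw [Complex.exp_add, Complex.exp_log h1z, mul_right_comm, ← hw, hz]
        field_simp
        ring
      · calc ‖w + Complex.log (1 + z)‖ ≤ ‖w‖ + ‖Complex.log (1 + z)‖ := norm_add_le _ _
          _ ≤ cumVar φ a b s * (1 + 3 * ε) + δ * (1 + 3 * δ) := add_le_add hwn hlog
          _ ≤ cumVar φ a b s * (1 + 3 * ε) + δ * (1 + 3 * ε) := by gcongr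
          _ = cumVar φ a b t * (1 + 3 * ε) := by rw [hδ]; ring
  obtain ⟨n, hn⟩ := exists_nat_ge ((b - a) / (d / 2))
  have hb : min b (a + n * (d / 2)) = b := by
    rw [div_le_iff₀ (by positivity)] at hn
    exact min_eq_left (by linarith)
  simpa only [hb] using key n

/-- The logarithm of the rotation-dilation that a time-ordered exponential effects on a vector is
bounded by the total variation. -/
theorem norm_log_action_lexp_le (hρ1 : ∀ v, ρ 1 v = v)
    (hρm : ∀ A B v, ρ (A * B) v = ρ A (ρ B v))
    (hρ : ∀ A v, ‖ρ A v‖ ≤ ‖A‖ * ‖v‖) (hfin : φ.variation (Icc a b) ≠ ∞)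
    (hat : ∀ x ∈ Icc a b, φ {x} = 0) (hab : a ≤ b) {v : ℂ} (hv : v ≠ 0) :
    ‖Complex.log (ρ (lexp φ a b) v / v)‖ ≤ (φ.variation (Icc a b)).toReal := by
  rw [← cumVar_right (φ := φ)]
  have h : ∀ ε : ℝ, 0 < ε → ε ≤ 1 / 4 →
      ‖Complex.log (ρ (lexp φ a b) v / v)‖ ≤ cumVar φ a b b * (1 + 3 * ε) := by
    intro ε hε hε'
    obtain ⟨w, hw, hwn⟩ := exists_log_action_lexp hρ1 hρm hρ hfin hat hab hv hε hε'
    rw [hw, mul_div_cancel_right₀ _ hv]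
    exact (norm_log_exp_le w).trans hwn
  have hlim : Filter.Tendsto (fun ε : ℝ => cumVar φ a b b * (1 + 3 * ε)) (nhdsWithin 0 (Ioi 0))
      (nhds (cumVar φ a b b)) := by
    have hc : Continuous fun ε : ℝ => cumVar φ a b b * (1 + 3 * ε) := by fun_prop
    simpa using (hc.tendsto 0).mono_left nhdsWithin_le_nhds
  refine ge_of_tendsto hlim ?_
  filter_upwards [Ioc_mem_nhdsGT (show (0 : ℝ) < 1 / 4 by norm_num)] with ε hε
  exact h ε hε.1 hε.2

end LowerBound

end Magnus

/-! ### Real 2 × 2 matrices as real-linear maps of ℂ; chiral disks. -/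

namespace Magnus

open scoped Matrix.Norms.L2Operator ComplexConjugate

/-- The complex linear part of a real `2 × 2` matrix: the center of its chiral disk. -/
noncomputable def linearPart (A : Matrix (Fin 2) (Fin 2) ℝ) : ℂ :=
  ⟨(A 0 0 + A 1 1) / 2, (A 1 0 - A 0 1) / 2⟩

/-- The complex antilinear part of a real `2 × 2` matrix. -/
noncomputable def antilinearPart (A : Matrix (Fin 2) (Fin 2) ℝ) : ℂ :=
  ⟨(A 0 0 - A 1 1) / 2, (A 0 1 + A 1 0) / 2⟩

theorem chiralDisk_eq (A : Matrix (Fin 2) (Fin 2) ℝ) :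
    chiralDisk A = Metric.closedBall (linearPart A) ‖antilinearPart A‖ := by
  rw [chiralDisk, linearPart, antilinearPart, Complex.norm_def, Complex.normSq_mk, sq, sq]

/-- The action of real `2 × 2` matrices on `ℂ ≅ ℝ²`. -/
noncomputable def planeAction : Matrix (Fin 2) (Fin 2) ℝ →ₗ[ℝ] ℂ →ₗ[ℝ] ℂ :=
  LinearMap.mk₂ ℝ
    (fun A v => ⟨A 0 0 * v.re + A 0 1 * v.im, A 1 0 * v.re + A 1 1 * v.im⟩)
    (by intros; apply Complex.ext <;> simp <;> ring)
    (by intros; apply Complex.ext <;> simp <;> ring)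
    (by intros; apply Complex.ext <;> simp <;> ring)
    (by intros; apply Complex.ext <;> simp <;> ring)

theorem planeAction_apply (A : Matrix (Fin 2) (Fin 2) ℝ) (v : ℂ) :
    planeAction A v = ⟨A 0 0 * v.re + A 0 1 * v.im, A 1 0 * v.re + A 1 1 * v.im⟩ := rfl

theorem planeAction_eq (A : Matrix (Fin 2) (Fin 2) ℝ) (v : ℂ) :
    planeAction A v = linearPart A * v + antilinearPart A * conj v := by
  apply Complex.ext <;> simp [planeAction_apply, linearPart, antilinearPart] <;> ring

theorem planeAction_one (v : ℂ) : planeAction 1 v = v := by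
  apply Complex.ext <;> simp [planeAction_apply]

theorem planeAction_mul (A B : Matrix (Fin 2) (Fin 2) ℝ) (v : ℂ) :
    planeAction (A * B) v = planeAction A (planeAction B v) := by
  apply Complex.ext <;> simp [planeAction_apply, Matrix.mul_apply, Fin.sum_univ_two] <;> ring

theorem norm_eq_toLp (v : ℂ) :
    ‖v‖ = ‖(WithLp.toLp 2 ![v.re, v.im] : EuclideanSpace ℝ (Fin 2))‖ := by
  rw [EuclideanSpace.norm_eq, Complex.norm_def, Complex.normSq_apply]
  simp [Fin.sum_univ_two, sq]

theorem norm_planeAction (A : Matrix (Fin 2) (Fin 2) ℝ) (v : ℂ) :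
    ‖planeAction A v‖ = ‖(EuclideanSpace.equiv (Fin 2) ℝ).symm
      (A.mulVec (WithLp.toLp 2 ![v.re, v.im] : EuclideanSpace ℝ (Fin 2)))‖ := by
  rw [norm_eq_toLp]
  congr 2
  ext i
  fin_cases i <;>
    simp [planeAction_apply, Matrix.mulVec, dotProduct, Fin.sum_univ_two]

theorem norm_planeAction_le (A : Matrix (Fin 2) (Fin 2) ℝ) (v : ℂ) :
    ‖planeAction A v‖ ≤ ‖A‖ * ‖v‖ := by
  rw [norm_planeAction, norm_eq_toLp v]
  exact Matrix.l2_opNorm_mulVec A _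

theorem opNorm_le_of_planeAction {A : Matrix (Fin 2) (Fin 2) ℝ} {C : ℝ} (hC : 0 ≤ C)
    (h : ∀ v, ‖planeAction A v‖ ≤ C * ‖v‖) : ‖A‖ ≤ C := by
  rw [Matrix.l2_opNorm_def]
  refine ContinuousLinearMap.opNorm_le_bound _ hC fun x => ?_
  have h1 := h ⟨x 0, x 1⟩
  have hx : (WithLp.toLp 2 ![x 0, x 1] : EuclideanSpace ℝ (Fin 2)) = x := by
    ext i
    fin_cases i <;> rfl
  rw [norm_planeAction, norm_eq_toLp, hx] at h1
  exact h1

theorem opNorm_le (A : Matrix (Fin 2) (Fin 2) ℝ) :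
    ‖A‖ ≤ ‖linearPart A‖ + ‖antilinearPart A‖ := by
  refine opNorm_le_of_planeAction (by positivity) fun v => ?_
  rw [planeAction_eq, add_mul]
  refine (norm_add_le _ _).trans ?_
  simp

/-- Every boundary point of the chiral disk bounds the norm of the presentations. -/
theorem norm_log_le_cumulativeNorm {A : Matrix (Fin 2) (Fin 2) ℝ} {a b : ℝ}
    {φ : VectorMeasure ℝ (Matrix (Fin 2) (Fin 2) ℝ)} (hφ : IsPresentation A a b φ)
    {z : ℂ} (hz : ‖z - linearPart A‖ = ‖antilinearPart A‖) :
    ENNReal.ofReal ‖Complex.log z‖ ≤ cumulativeNorm a b φ := by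
  by_cases hfin : cumulativeNorm a b φ = ∞
  · simp [hfin]
  obtain ⟨hab, hat, hA⟩ := hφ
  obtain ⟨v, hv, hvz⟩ : ∃ v : ℂ, v ≠ 0 ∧ planeAction A v / v = z := by
    set q := antilinearPart A
    obtain ⟨θ, hθ⟩ : ∃ θ : ℝ, z - linearPart A = q * Complex.exp (θ * Complex.I) := by
      rcases eq_or_ne q 0 with h0 | h0
      · exact ⟨0, by rw [h0, norm_zero, norm_eq_zero] at hz; rw [hz, h0, zero_mul]⟩
      · refine ⟨((z - linearPart A) / q).arg, ?_⟩
        have h1 := Complex.norm_mul_exp_arg_mul_I ((z - linearPart A) / q)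
        rw [norm_div, hz, div_self (norm_ne_zero_iff.2 h0), Complex.ofReal_one, one_mul] at h1
        rw [h1]
        field_simp
    -- For v = e^{-iθ/2} the quotient v̄/v is e^{iθ}, so A v / v is the boundary point at angle θ
    -- relative to q.
    refine ⟨Complex.exp (-((θ / 2 : ℝ) : ℂ) * Complex.I), Complex.exp_ne_zero _, ?_⟩
    rw [planeAction_eq, add_div, mul_div_cancel_right₀ _ (Complex.exp_ne_zero _), mul_div_assoc,
      ← Complex.exp_conj, ← Complex.exp_sub]
    have h2 : conj (-((θ / 2 : ℝ) : ℂ) * Complex.I) - -((θ / 2 : ℝ) : ℂ) * Complex.I =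
        θ * Complex.I := by
      rw [map_mul, map_neg, Complex.conj_ofReal, Complex.conj_I]
      push_cast
      ring
    rw [h2, ← hθ]
    ring
  have h := norm_log_action_lexp_le planeAction_one planeAction_mul norm_planeAction_le
    hfin hat hab hv
  rw [hA, hvz] at h
  exact (ENNReal.ofReal_le_iff_le_toReal hfin).2 h

end Magnus

/-! ### Measures with continuous density and linear differential equations. -/

namespace Magnus

section Density

variable {𝔄 : Type*} [NormedRing 𝔄] [NormedAlgebra ℝ 𝔄] [CompleteSpace 𝔄]

theorem isFiniteMeasure_variation_withDensityᵥ {μ : Measure ℝ} {Φ : ℝ → 𝔄}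
    (hΦ : Integrable Φ μ) : IsFiniteMeasure (μ.withDensityᵥ Φ).variation := by
  rw [Measure.variation_withDensityᵥ hΦ]
  exact isFiniteMeasure_withDensity hΦ.2.ne

theorem integral_withDensityᵥ_simpleFunc {μ : Measure ℝ} [IsFiniteMeasure μ] {Φ : ℝ → 𝔄}
    (hΦ : Integrable Φ μ) (f : SimpleFunc ℝ 𝔄) :
    VectorMeasure.integral (μ.withDensityᵥ Φ) f (ContinuousLinearMap.mul ℝ 𝔄).flip
      = ∫ x, Φ x * f x ∂μ := by
  have := isFiniteMeasure_variation_withDensityᵥ hΦ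
  induction f using SimpleFunc.induction with
  | @const c s hs =>
    classical
    rw [SimpleFunc.coe_piecewise, SimpleFunc.coe_const, SimpleFunc.coe_const,
      Function.const_zero, piecewise_eq_indicator]
    have h1 := VectorMeasure.integral_indicator_const (μ := μ.withDensityᵥ Φ)
      (B := (ContinuousLinearMap.mul ℝ 𝔄).flip) c hs
    refine h1.trans ?_
    rw [ContinuousLinearMap.flip_apply, ContinuousLinearMap.mul_apply', withDensityᵥ_apply hΦ hs,
      ← integral_mul_const_of_integrable hΦ.integrableOn, ← integral_indicator hs]
    congr 1
    funext x
    by_cases hx : x ∈ s <;> simp [indicator, hx]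
  | @add f g hfg hf hg =>
    have hb : ∀ h : SimpleFunc ℝ 𝔄, ∃ C, ∀ x, ‖h x‖ ≤ C := fun h => h.exists_forall_norm_le
    have hi : ∀ h : SimpleFunc ℝ 𝔄, Integrable (fun x => Φ x * h x) μ := by
      intro h
      obtain ⟨C, hC⟩ := hb h
      exact hΦ.mul_bdd (c := C) h.aestronglyMeasurable (Filter.Eventually.of_forall hC)
    rw [SimpleFunc.coe_add, VectorMeasure.integral_add (SimpleFunc.integrable_of_isFiniteMeasure f)
      (SimpleFunc.integrable_of_isFiniteMeasure g), hf, hg, ← integral_add (hi f) (hi g)]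
    simp [mul_add]

/-- Uniformly bounded simple functions approximate `f` almost everywhere; dominated convergence
applies on both sides because the variation is absolutely continuous with respect to `μ`. -/
theorem integral_withDensityᵥ {μ : Measure ℝ} [IsFiniteMeasure μ] {Φ : ℝ → 𝔄}
    (hΦ : Integrable Φ μ) {f : ℝ → 𝔄} (hf : StronglyMeasurable f) {c : ℝ} (hc0 : 0 ≤ c)
    (hc : ∀ᵐ x ∂μ, ‖f x‖ ≤ c) :
    VectorMeasure.integral (μ.withDensityᵥ Φ) f (ContinuousLinearMap.mul ℝ 𝔄).flip
      = ∫ x, Φ x * f x ∂μ := by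
  have := isFiniteMeasure_variation_withDensityᵥ hΦ
  have hac : (μ.withDensityᵥ Φ).variation ≪ μ := by
    rw [Measure.variation_withDensityᵥ hΦ]
    exact withDensity_absolutelyContinuous _ _
  have hlim : ∀ᵐ x ∂μ, Filter.Tendsto (fun n => hf.approxBounded c n x) Filter.atTop
      (nhds (f x)) := hf.tendsto_approxBounded_ae hc
  have h1 : Filter.Tendsto (fun n => VectorMeasure.integral (μ.withDensityᵥ Φ)
      (hf.approxBounded c n) (ContinuousLinearMap.mul ℝ 𝔄).flip) Filter.atTop
      (nhds (VectorMeasure.integral (μ.withDensityᵥ Φ) f (ContinuousLinearMap.mul ℝ 𝔄).flip)) :=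
    VectorMeasure.tendsto_integral_of_dominated_convergence (fun _ => c)
      (fun n => (hf.approxBounded c n).aestronglyMeasurable) (integrable_const _)
      (fun n => Filter.Eventually.of_forall fun x => hf.norm_approxBounded_le hc0 n x)
      (hac.ae_le hlim)
  have h2 : Filter.Tendsto (fun n => ∫ x, Φ x * hf.approxBounded c n x ∂μ) Filter.atTop
      (nhds (∫ x, Φ x * f x ∂μ)) := by
    refine tendsto_integral_of_dominated_convergence (fun x => ‖Φ x‖ * c)
      (fun n => hΦ.aestronglyMeasurable.mul (hf.approxBounded c n).aestronglyMeasurable)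
      (hΦ.norm.mul_const c) (fun n => Filter.Eventually.of_forall fun x => ?_) ?_
    · refine (norm_mul_le _ _).trans ?_
      have := hf.norm_approxBounded_le hc0 n x
      gcongr
    · filter_upwards [hlim] with x hx using hx.const_mul (Φ x)
  simp only [integral_withDensityᵥ_simpleFunc hΦ] at h1
  exact tendsto_nhds_unique h1 h2

omit [CompleteSpace 𝔄] in
theorem restrict_withDensityᵥ_restrict {Φ : ℝ → 𝔄} {s t : Set ℝ} (ht : MeasurableSet t)
    (hts : t ⊆ s) (hΦ : IntegrableOn Φ s volume) :
    ((volume.restrict s).withDensityᵥ Φ).restrict t = (volume.restrict t).withDensityᵥ Φ := by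
  ext r hr
  rw [VectorMeasure.restrict_apply _ ht hr, withDensityᵥ_apply hΦ (hr.inter ht),
    withDensityᵥ_apply (hΦ.mono_set hts) hr, Measure.restrict_restrict (hr.inter ht),
    Measure.restrict_restrict hr, inter_assoc, inter_eq_left.2 hts]

variable {Φ U : ℝ → 𝔄} {l : ℝ}

theorem variation_withDensityᵥ_Icc_le (hΦ : Continuous Φ) (h1 : ∀ t, ‖Φ t‖ ≤ 1) :
    ((volume.restrict (Icc 0 l)).withDensityᵥ Φ).variation (Icc 0 l) ≤ ENNReal.ofReal l := by
  rw [Measure.variation_withDensityᵥ (hΦ.integrableOn_Icc), withDensity_apply _ measurableSet_Icc,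
    Measure.restrict_restrict measurableSet_Icc, inter_self]
  calc ∫⁻ x in Icc 0 l, ‖Φ x‖ₑ ≤ ∫⁻ _ in Icc 0 l, 1 := by
        refine lintegral_mono fun x => ?_
        rw [← ofReal_norm, ← ENNReal.ofReal_one]
        exact ENNReal.ofReal_le_ofReal (h1 x)
    _ = ENNReal.ofReal l := by simp

omit [CompleteSpace 𝔄] in
theorem withDensityᵥ_singleton (hΦ : Continuous Φ) (x : ℝ) :
    ((volume.restrict (Icc 0 l)).withDensityᵥ Φ) {x} = 0 := by
  rw [withDensityᵥ_apply hΦ.integrableOn_Icc (measurableSet_singleton x)]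
  refine setIntegral_measure_zero Φ ?_
  exact nonpos_iff_eq_zero.1 ((Measure.restrict_apply_le _ _).trans_eq Real.volume_singleton)

/-- The time-ordered exponential of a continuous density is the solution of the linear differential
equation. -/
theorem lexp_withDensityᵥ (hΦ : Continuous Φ) (h1 : ∀ t, ‖Φ t‖ ≤ 1) (hl : 0 ≤ l) (hU0 : U 0 = 1)
    (hU : ∀ t, HasDerivAt U (Φ t * U t) t) :
    lexp ((volume.restrict (Icc 0 l)).withDensityᵥ Φ) 0 l = U l := by
  have hUc : Continuous U := continuous_iff_continuousAt.2 fun t => (hU t).continuousAt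
  have hfin : ((volume.restrict (Icc 0 l)).withDensityᵥ Φ).variation (Icc 0 l) ≠ ∞ :=
    ((variation_withDensityᵥ_Icc_le hΦ h1).trans_lt ENNReal.ofReal_lt_top).ne
  refine eq_lexp_of_eq_one_add_leftIntegral hfin (fun x _ => withDensityᵥ_singleton hΦ x)
    hUc.continuousOn (fun t ht => ?_) (right_mem_Icc.2 hl)
  obtain ⟨C, hC⟩ := isCompact_Icc.exists_bound_of_continuousOn (s := Icc 0 t) hUc.continuousOn
  have hb : ∀ᵐ x ∂(volume.restrict (Icc 0 t)), ‖U x‖ ≤ max C 0 :=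
    (ae_restrict_iff' measurableSet_Icc).2
      (Filter.Eventually.of_forall fun x hx => (hC x hx).trans (le_max_left _ _))
  rw [leftIntegral, restrict_withDensityᵥ_restrict measurableSet_Icc (Icc_subset_Icc_right ht.2)
    hΦ.integrableOn_Icc, integral_withDensityᵥ hΦ.integrableOn_Icc hUc.stronglyMeasurable
    (le_max_right _ _) hb, integral_Icc_eq_integral_Ioc, ← intervalIntegral.integral_of_le ht.1,
    intervalIntegral.integral_eq_sub_of_hasDerivAt (fun s _ => hU s)
      ((hΦ.mul hUc).intervalIntegrable _ _), hU0]
  abel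

end Density

open scoped Matrix.Norms.L2Operator in
/-- The endpoint of a solution of a linear differential equation with contractive coefficients has
Magnus exponent at most the duration. -/
theorem magnusExponent_le_of_hasDerivAt {Φ U : ℝ → Matrix (Fin 2) (Fin 2) ℝ} {l : ℝ}
    (hΦ : Continuous Φ) (h1 : ∀ t, ‖Φ t‖ ≤ 1) (hl : 0 ≤ l) (hU0 : U 0 = 1)
    (hU : ∀ t, HasDerivAt U (Φ t * U t) t) : magnusExponent (U l) ≤ ENNReal.ofReal l := by
  refine le_trans (b := cumulativeNorm 0 l ((volume.restrict (Icc 0 l)).withDensityᵥ Φ))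
    (sInf_le ⟨0, l, _, ⟨hl, fun x _ => ?_, ?_⟩, rfl⟩) ?_
  · exact withDensityᵥ_singleton hΦ x
  · exact lexp_withDensityᵥ hΦ h1 hl hU0 hU
  · exact variation_withDensityᵥ_Icc_le hΦ h1

end Magnus

/-! ### Explicit flows with a uniformly rotating coefficient. -/

namespace Magnus

open scoped Matrix.Norms.L2Operator ComplexConjugate

/-- The real matrix of `v ↦ p v + q v̄`. -/
def pairMatrix : ℂ × ℂ →ₗ[ℝ] Matrix (Fin 2) (Fin 2) ℝ where
  toFun x := !![x.1.re + x.2.re, x.2.im - x.1.im; x.1.im + x.2.im, x.1.re - x.2.re]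
  map_add' x y := by
    ext i j
    fin_cases i <;> fin_cases j <;> simp <;> ring
  map_smul' c x := by
    ext i j
    fin_cases i <;> fin_cases j <;> simp <;> ring

theorem pairMatrix_apply (p q : ℂ) :
    pairMatrix (p, q) = !![p.re + q.re, q.im - p.im; p.im + q.im, p.re - q.re] := rfl

theorem linearPart_pairMatrix (p q : ℂ) : linearPart (pairMatrix (p, q)) = p := by
  apply Complex.ext <;> simp [linearPart, pairMatrix_apply]
  ring

theorem antilinearPart_pairMatrix (p q : ℂ) : antilinearPart (pairMatrix (p, q)) = q := by
  apply Complex.ext <;> simp [antilinearPart, pairMatrix_apply]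
  ring

theorem pairMatrix_linearPart_antilinearPart (A : Matrix (Fin 2) (Fin 2) ℝ) :
    pairMatrix (linearPart A, antilinearPart A) = A := by
  ext i j
  fin_cases i <;> fin_cases j <;> simp [linearPart, antilinearPart, pairMatrix_apply] <;> ring

theorem pairMatrix_one : pairMatrix (1, 0) = 1 := by
  ext i j
  fin_cases i <;> fin_cases j <;> simp [pairMatrix_apply]

theorem pairMatrix_mul (x y p q : ℂ) :
    pairMatrix (x, y) * pairMatrix (p, q)
      = pairMatrix (x * p + y * conj q, x * q + y * conj p) := by
  ext i j
  fin_cases i <;> fin_cases j <;>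
    simp [pairMatrix_apply, Matrix.mul_apply, Fin.sum_univ_two] <;> ring

theorem norm_pairMatrix_le (p q : ℂ) : ‖pairMatrix (p, q)‖ ≤ ‖p‖ + ‖q‖ := by
  simpa only [linearPart_pairMatrix, antilinearPart_pairMatrix] using opNorm_le (pairMatrix (p, q))

theorem continuous_pairMatrix : Continuous pairMatrix :=
  pairMatrix.continuous_of_finiteDimensional

theorem hasDerivAt_pairMatrix {p q : ℝ → ℂ} {p' q' : ℂ} {t : ℝ} (hp : HasDerivAt p p' t)
    (hq : HasDerivAt q q' t) :
    HasDerivAt (fun s => pairMatrix (p s, q s)) (pairMatrix (p', q')) t :=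
  (LinearMap.toContinuousLinearMap pairMatrix).hasFDerivAt.comp_hasDerivAt t (hp.prodMk hq)

/-- The function `sinh (c τ) / c`, continued by `τ` at `c = 0`. -/
noncomputable def sinhDiv (c τ : ℝ) : ℝ := if c = 0 then τ else Real.sinh (c * τ) / c

theorem sinhDiv_zero_left (τ : ℝ) : sinhDiv 0 τ = τ := by simp [sinhDiv]

theorem sinhDiv_zero (c : ℝ) : sinhDiv c 0 = 0 := by simp [sinhDiv]

theorem mul_sinhDiv (c τ : ℝ) : c * sinhDiv c τ = Real.sinh (c * τ) := by
  by_cases hc : c = 0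
  · simp [hc]
  · rw [sinhDiv, if_neg hc]
    field_simp

theorem hasDerivAt_sinhDiv (c τ : ℝ) : HasDerivAt (sinhDiv c) (Real.cosh (c * τ)) τ := by
  by_cases hc : c = 0
  · subst hc
    have h : sinhDiv 0 = id := funext sinhDiv_zero_left
    simpa [h] using hasDerivAt_id τ
  · have h : sinhDiv c = fun τ => Real.sinh (c * τ) / c := by
      funext τ
      rw [sinhDiv, if_neg hc]
    rw [h]
    have h1 := (((hasDerivAt_id τ).const_mul c).sinh).div_const c
    simp only [id, mul_one] at h1
    rwa [mul_div_cancel_right₀ _ hc] at h1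

theorem continuous_sinhDiv (c : ℝ) : Continuous (sinhDiv c) :=
  continuous_iff_continuousAt.2 fun τ => (hasDerivAt_sinhDiv c τ).continuousAt

theorem sinhDiv_pos (c : ℝ) {τ : ℝ} (hτ : 0 < τ) : 0 < sinhDiv c τ := by
  have h : StrictMono (sinhDiv c) := strictMono_of_deriv_pos fun x => by
    rw [(hasDerivAt_sinhDiv c x).deriv]
    exact Real.cosh_pos _
  simpa [sinhDiv_zero] using h hτ

/-- Linear part of the solution generated by a uniformly rotating coefficient. -/
noncomputable def flowLinear (c ω ρ t : ℝ) : ℂ :=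
  Complex.exp (t * ((1 - ρ) * c + ω * Complex.I)) *
    (Real.cosh (c * (ρ * t)) - ω * Complex.I * sinhDiv c (ρ * t))

/-- Antilinear part of the solution generated by a uniformly rotating coefficient. -/
noncomputable def flowAntilinear (c ω ρ : ℝ) (k : ℂ) (t : ℝ) : ℂ :=
  Complex.exp (t * ((1 - ρ) * c + ω * Complex.I)) * (sinhDiv c (ρ * t) * k)

theorem hasDerivAt_flowExp (c ω ρ t : ℝ) :
    HasDerivAt (fun t : ℝ => Complex.exp (t * ((1 - ρ) * c + ω * Complex.I)))
      (Complex.exp (t * ((1 - ρ) * c + ω * Complex.I)) * ((1 - ρ) * c + ω * Complex.I)) t := by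
  have h := ((hasDerivAt_id t).ofReal_comp.mul_const
    ((1 - (ρ : ℂ)) * c + ω * Complex.I)).cexp
  simpa using h

theorem hasDerivAt_flowSinh (c ρ t : ℝ) :
    HasDerivAt (fun t : ℝ => (sinhDiv c (ρ * t) : ℂ)) (ρ * Real.cosh (c * (ρ * t)) : ℝ) t := by
  have h := (hasDerivAt_sinhDiv c (ρ * t)).comp t ((hasDerivAt_id t).const_mul ρ)
  have h2 := h.ofReal_comp
  simp only [mul_one, mul_comm _ ρ] at h2
  exact h2

theorem hasDerivAt_flowCosh (c ρ t : ℝ) :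
    HasDerivAt (fun t : ℝ => (Real.cosh (c * (ρ * t)) : ℂ))
      (ρ * c ^ 2 * sinhDiv c (ρ * t) : ℝ) t := by
  have h := (((hasDerivAt_id t).const_mul ρ).const_mul c).cosh.ofReal_comp
  have h3 : ρ * c ^ 2 * sinhDiv c (ρ * t) = Real.sinh (c * (ρ * t)) * (c * (ρ * 1)) := by
    rw [← mul_sinhDiv]
    ring
  rw [h3]
  exact h

theorem exp_two_mul_conj_exp (x ω t : ℝ) :
    Complex.exp (2 * ω * t * Complex.I) * conj (Complex.exp (t * (x + ω * Complex.I)))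
      = Complex.exp (t * (x + ω * Complex.I)) := by
  rw [← Complex.exp_conj, ← Complex.exp_add]
  congr 1
  simp
  ring

variable {c ω ρ : ℝ} {k : ℂ}

/-- In the frame rotating by e^{iωt} the coefficient is the constant (1-ρ)c + ρN with N w = -iω w +
k w̄. Since N² = |k|² - ω² = c², its exponential is e^{(1-ρ)ct} times cosh(cρt) + (sinh(cρt)/c) N,
which gives both parts of the flow. -/
theorem hasDerivAt_flowLinear (hcω : c ^ 2 + ω ^ 2 = 1) (hk : ‖k‖ = 1) (t : ℝ) :
    HasDerivAt (flowLinear c ω ρ)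
      ((1 - ρ) * (c + ω * Complex.I) * flowLinear c ω ρ t +
        ρ * k * Complex.exp (2 * ω * t * Complex.I) * conj (flowAntilinear c ω ρ k t)) t := by
  have h := (hasDerivAt_flowExp c ω ρ t).mul
    ((hasDerivAt_flowCosh c ρ t).sub ((hasDerivAt_flowSinh c ρ t).const_mul (ω * Complex.I)))
  refine h.congr_deriv ?_
  have hE := exp_two_mul_conj_exp ((1 - ρ) * c) ω t
  have hkk : k * conj k = 1 := by rw [Complex.mul_conj, Complex.normSq_eq_norm_sq, hk]; simp
  have hcω' : (c : ℂ) ^ 2 + (ω : ℂ) ^ 2 = 1 := by exact_mod_cast hcω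
  simp only [Pi.sub_apply]
  rw [flowLinear, flowAntilinear, map_mul, map_mul, Complex.conj_ofReal]
  push_cast at hE ⊢
  set E := Complex.exp (t * ((1 - ρ) * c + ω * Complex.I))
  set S : ℂ := Complex.ofReal (sinhDiv c (ρ * t))
  set C := Complex.cosh (c * (ρ * t))
  linear_combination (-(ρ * S * k * conj k)) * hE - ρ * S * E * hkk + ρ * S * E * hcω'
    - ρ * ω ^ 2 * S * E * Complex.I_sq

theorem hasDerivAt_flowAntilinear (t : ℝ) :
    HasDerivAt (flowAntilinear c ω ρ k)
      ((1 - ρ) * (c + ω * Complex.I) * flowAntilinear c ω ρ k t +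
        ρ * k * Complex.exp (2 * ω * t * Complex.I) * conj (flowLinear c ω ρ t)) t := by
  have h := (hasDerivAt_flowExp c ω ρ t).mul ((hasDerivAt_flowSinh c ρ t).mul_const k)
  refine h.congr_deriv ?_
  have hE := exp_two_mul_conj_exp ((1 - ρ) * c) ω t
  rw [flowLinear, flowAntilinear, map_mul, map_sub, map_mul, map_mul, Complex.conj_ofReal,
    Complex.conj_ofReal, Complex.conj_ofReal, Complex.conj_I]
  push_cast at hE ⊢
  set E := Complex.exp (t * ((1 - ρ) * c + ω * Complex.I))
  set S : ℂ := Complex.ofReal (sinhDiv c (ρ * t))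
  set C := Complex.cosh (c * (ρ * t))
  linear_combination (-(ρ * k * (C + ω * Complex.I * S))) * hE

theorem magnusExponent_flow_le (hcω : c ^ 2 + ω ^ 2 = 1) (hk : ‖k‖ = 1) (hρ : ρ ∈ Icc (0 : ℝ) 1)
    {l : ℝ} (hl : 0 ≤ l) :
    magnusExponent (pairMatrix (flowLinear c ω ρ l, flowAntilinear c ω ρ k l))
      ≤ ENNReal.ofReal l := by
  refine magnusExponent_le_of_hasDerivAt
    (Φ := fun t => pairMatrix ((1 - ρ) * (c + ω * Complex.I),
      ρ * k * Complex.exp (2 * ω * t * Complex.I)))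
    (U := fun t => pairMatrix (flowLinear c ω ρ t, flowAntilinear c ω ρ k t))
    (continuous_pairMatrix.comp (by fun_prop)) (fun t => ?_) hl ?_ (fun t => ?_)
  · refine (norm_pairMatrix_le _ _).trans ?_
    -- The linear and antilinear parts of the coefficient have moduli 1-ρ and ρ, so the operator
    -- norm is at most 1.
    have h1 : ‖(c : ℂ) + ω * Complex.I‖ = 1 := by
      rw [Complex.norm_add_mul_I, hcω, Real.sqrt_one]
    have h2 : ‖Complex.exp (2 * ω * t * Complex.I)‖ = 1 := by
      have := Complex.norm_exp_ofReal_mul_I (2 * ω * t)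
      push_cast at this
      exact this
    have h3 : ‖(1 : ℂ) - ρ‖ = 1 - ρ := by
      rw [← Complex.ofReal_one, ← Complex.ofReal_sub, Complex.norm_real, Real.norm_eq_abs,
        abs_of_nonneg (by linarith [hρ.2])]
    have h4 : ‖(ρ : ℂ)‖ = ρ := by
      rw [Complex.norm_real, Real.norm_eq_abs, abs_of_nonneg hρ.1]
    rw [norm_mul, norm_mul, norm_mul, h1, h2, h3, h4, hk]
    linarith
  · simp only [flowLinear, flowAntilinear, mul_zero, sinhDiv_zero, Real.cosh_zero]
    simp [pairMatrix_one]
  · rw [pairMatrix_mul]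
    exact hasDerivAt_pairMatrix (hasDerivAt_flowLinear hcω hk t) (hasDerivAt_flowAntilinear t)

end Magnus

/-! ### Disks on which |log| is maximal at a given point. -/

namespace Magnus

open scoped ComplexConjugate

/-- First-order condition at a maximum of `|log|` on a convex set. -/
theorem re_conj_log_mul_nonpos {D : Set ℂ} (hD : Convex ℝ D) {z₀ z : ℂ} (hz₀ : z₀ ∈ D)
    (hz : z ∈ D) (hs : z₀ ∈ Complex.slitPlane)
    (hmax : ∀ z ∈ D, ‖Complex.log z‖ ≤ ‖Complex.log z₀‖) :
    (conj (Complex.log z₀) * ((z - z₀) / z₀)).re ≤ 0 := by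
  have hline : HasDerivAt (fun t : ℝ => z₀ + t * (z - z₀)) (z - z₀) 0 := by
    simpa using ((hasDerivAt_id (0 : ℝ)).ofReal_comp.mul_const (z - z₀)).const_add z₀
  have hlog : HasDerivAt (fun t : ℝ => Complex.log (z₀ + t * (z - z₀))) ((z - z₀) / z₀) 0 := by
    simpa using hline.clog_real (by simpa using hs)
  have hsq := hlog.norm_sq
  simp only [Complex.ofReal_zero, zero_mul, add_zero] at hsq
  have hmaxOn : IsLocalMaxOn (fun t : ℝ => ‖Complex.log (z₀ + t * (z - z₀))‖ ^ 2) (Icc 0 1) 0 := by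
    refine IsMaxOn.localize fun t ht => ?_
    have hmem : z₀ + t * (z - z₀) ∈ D := by
      have := hD.add_smul_sub_mem hz₀ hz ht
      simpa using this
    have := hmax _ hmem
    simp only [Complex.ofReal_zero, zero_mul, add_zero, mem_ofPred_eq]
    gcongr
  have hcone : (1 : ℝ) ∈ posTangentConeAt (Icc (0 : ℝ) 1) 0 := by
    refine mem_posTangentConeAt_of_segment_subset ?_
    simp [segment_eq_Icc]
  have h := hmaxOn.hasFDerivWithinAt_nonpos hsq.hasFDerivAt.hasFDerivWithinAt hcone
  have h2 : 2 * inner ℝ (Complex.log z₀) ((z - z₀) / z₀) ≤ 0 := by simpa using h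
  rw [Complex.inner] at h2
  rw [mul_comm (conj _)]
  linarith

theorem eq_ofReal_of_norm_le_of_le_re {x : ℂ} {K : ℝ} (h1 : ‖x‖ ≤ K) (h2 : K ≤ x.re) : x = K := by
  have h3 : x.re = K := le_antisymm ((Complex.re_le_norm x).trans h1) h2
  have h0 : 0 ≤ K := (norm_nonneg x).trans h1
  have h4 : x.re * x.re + x.im * x.im ≤ K * K := by
    rw [← Complex.normSq_apply, Complex.normSq_eq_norm_sq, sq]
    gcongr
  have h5 : x.im = 0 := by
    rw [h3] at h4
    nlinarith [mul_self_nonneg x.im]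
  apply Complex.ext <;> simp [h3, h5]

/-- At a maximum of `|log|` on a disk, the disk is tangent to the level curve. -/
theorem sub_center_eq_of_isMax {p : ℂ} {r l θ : ℝ} (hr : 0 ≤ r) (hl : 0 < l)
    (hs : Complex.exp (l * Complex.exp (θ * Complex.I)) ∈ Complex.slitPlane)
    (hlog : Complex.log (Complex.exp (l * Complex.exp (θ * Complex.I)))
      = l * Complex.exp (θ * Complex.I))
    (hz₀ : Complex.exp (l * Complex.exp (θ * Complex.I)) ∈ Metric.closedBall p r)
    (hmax : ∀ z ∈ Metric.closedBall p r, ‖Complex.log z‖ ≤ l) :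
    Complex.exp (l * Complex.exp (θ * Complex.I)) - p
      = r * (Complex.exp (θ * Complex.I) * Complex.exp (l * Real.sin θ * Complex.I)) := by
  set e := Complex.exp (θ * Complex.I) with he
  set z₀ := Complex.exp (l * e) with hz₀def
  set m := Complex.exp (l * Real.sin θ * Complex.I) with hm
  have hen : ‖e‖ = 1 := Complex.norm_exp_ofReal_mul_I θ
  have hmn : ‖m‖ = 1 := by
    have := Complex.norm_exp_ofReal_mul_I (l * Real.sin θ)
    rwa [Complex.ofReal_mul] at this
  have hee : conj e * e = 1 := by
    rw [mul_comm, Complex.mul_conj, Complex.normSq_eq_norm_sq, hen]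
    simp
  have hz₀0 : z₀ ≠ 0 := Complex.exp_ne_zero _
  have hz₀m : z₀ = ‖z₀‖ * m := by
    rw [hz₀def, Complex.norm_exp, hm, Complex.ofReal_exp, ← Complex.exp_add]
    congr 1
    rw [he, Complex.exp_mul_I, ← Complex.ofReal_cos, ← Complex.ofReal_sin]
    simp
    ring
  have hn0 : (‖z₀‖ : ℂ) ≠ 0 := by
    rw [Ne, Complex.ofReal_eq_zero, norm_eq_zero]
    exact hz₀0
  have hm0 : m ≠ 0 := Complex.exp_ne_zero _
  have hle : ‖Complex.log z₀‖ = l := by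
    rw [hlog, norm_mul, hen, mul_one, Complex.norm_real, Real.norm_eq_abs, abs_of_pos hl]
  -- The gradient of |log|² at `z₀` points along `e * m`, so this is the disk point where the
  -- first-order condition is sharpest.
  have hext : p + r * (e * m) ∈ Metric.closedBall p r := by
    rw [mem_closedBall_iff_norm, add_sub_cancel_left, norm_mul, norm_mul, hen, hmn,
      Complex.norm_real, Real.norm_eq_abs, abs_of_nonneg hr]
    simp
  have hfo := re_conj_log_mul_nonpos (convex_closedBall p r) hz₀ hext hs
    (fun z hz => (hmax z hz).trans hle.ge)
  rw [hlog] at hfo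
  set x := conj e * ((z₀ - p) / m) with hx
  have hkey : conj (l * e) * ((p + r * (e * m) - z₀) / z₀) = ((l / ‖z₀‖ : ℝ) : ℂ) * (r - x) := by
    rw [hx, map_mul, Complex.conj_ofReal]
    push_cast
    nth_rewrite 2 [hz₀m]
    field_simp
    linear_combination l * r * m * hee
  rw [hkey, Complex.re_ofReal_mul] at hfo
  have hpos : 0 < l / ‖z₀‖ := div_pos hl (norm_pos_iff.2 hz₀0)
  have hre : r ≤ x.re := by
    have : ((r : ℂ) - x).re ≤ 0 := nonpos_of_mul_nonpos_right hfo hpos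
    simpa using this
  have hxn : ‖x‖ ≤ r := by
    rw [hx, norm_mul, norm_div, hmn, RCLike.norm_conj, hen, one_mul, div_one]
    exact mem_closedBall_iff_norm.1 hz₀
  have hxr := eq_ofReal_of_norm_le_of_le_re hxn hre
  have h7 : z₀ - p = e * m * x := by
    rw [hx]
    field_simp
    linear_combination (-(z₀ - p)) * hee
  rw [h7, hxr]
  ring

theorem log_exp_of_abs_im_lt {w : ℂ} (h : |w.im| < Real.pi) : Complex.log (Complex.exp w) = w :=
  Complex.log_exp (abs_lt.1 h).1 (abs_lt.1 h).2.le

/-- Both sides equal 1 at β = 0, with derivatives l and r. -/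
theorem exists_cos_add_mul_sin_ge_exp {l r : ℝ} (hl : 0 < l) (hlr : l < r) :
    ∃ β : ℝ, 0 < β ∧ β < l ∧ Real.exp (l * β) ≤ Real.cos β + r * Real.sin β := by
  have hd : HasDerivAt (fun β : ℝ => Real.cos β + r * Real.sin β - Real.exp (l * β)) (r - l) 0 := by
    have h1 := ((Real.hasDerivAt_cos 0).add ((Real.hasDerivAt_sin 0).const_mul r)).sub
      (((hasDerivAt_id (0 : ℝ)).const_mul l).exp)
    refine (h1.congr_deriv (by simp)).congr_of_eventuallyEq
      (Filter.Eventually.of_forall fun _ => rfl)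
  have hslope := (hasDerivAt_iff_tendsto_slope.1 hd).eventually (lt_mem_nhds (sub_pos.2 hlr))
  have hslope' := hslope.filter_mono
    (nhdsWithin_mono 0 (s := Ioi (0 : ℝ)) fun x (hx : 0 < x) => hx.ne')
  obtain ⟨β, hβ, hβl⟩ := (hslope'.and (Ioo_mem_nhdsGT hl)).exists
  refine ⟨β, hβl.1, hβl.2, ?_⟩
  rw [slope_def_field] at hβ
  have h2 := (div_pos_iff_of_pos_right (by linarith [hβl.1])).1 hβ
  simp only [Real.cos_zero, Real.sin_zero, mul_zero, Real.exp_zero] at h2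
  linarith

theorem normSq_exp_sub {x y : ℝ} (C S : ℝ) :
    Complex.normSq (Complex.exp (x + y * Complex.I) - (C + S * Complex.I))
      = (Real.exp x * Real.cos y - C) ^ 2 + (Real.exp x * Real.sin y - S) ^ 2 := by
  rw [Complex.normSq_apply]
  simp [Complex.exp_re, Complex.exp_im]
  ring

/-- The radius of a disk tangent to a level curve of `|log|` from the inside. -/
theorem radius_le_sinhDiv {p : ℂ} {c ω r l : ℝ} (hcω : c ^ 2 + ω ^ 2 = 1) (hl : 0 < l)
    (hlπ : l < Real.pi)
    (hp : p = Complex.exp (l * ω * Complex.I) *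
      (Real.exp (l * c) - r * (c + ω * Complex.I)))
    (hmax : ∀ z ∈ Metric.closedBall p r, ‖Complex.log z‖ ≤ l) : r ≤ sinhDiv c l := by
  by_contra! hlt
  have hS := sinhDiv_pos c hl
  have hωabs : |ω| ≤ 1 := abs_le_one_iff_mul_self_le_one.2 (by nlinarith [sq_nonneg c])
  have hdist : ∀ x y : ℝ, ‖Complex.exp (x + (l * ω + y) * Complex.I) - p‖ =
      Real.sqrt ((Real.exp x * Real.cos y - (Real.exp (l * c) - r * c)) ^ 2 +
        (Real.exp x * Real.sin y - -(r * ω)) ^ 2) := by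
    intro x y
    have h1 : Complex.exp (x + (l * ω + y) * Complex.I) - p =
        Complex.exp (l * ω * Complex.I) * (Complex.exp (x + y * Complex.I) -
          ((Real.exp (l * c) - r * c : ℝ) + (-(r * ω) : ℝ) * Complex.I)) := by
      have h3 : Complex.exp (x + (l * ω + y) * Complex.I) =
          Complex.exp (l * ω * Complex.I) * Complex.exp (x + y * Complex.I) := by
        rw [← Complex.exp_add]
        ring_nf
      rw [hp, h3]
      push_cast
      ring
    have h2 : ‖Complex.exp (l * ω * Complex.I)‖ = 1 := by
      have := Complex.norm_exp_ofReal_mul_I (l * ω)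
      rwa [Complex.ofReal_mul] at this
    rw [h1, norm_mul, h2, one_mul, Complex.norm_def, normSq_exp_sub]
  have hcontra : ∀ x y : ℝ, |l * ω + y| < Real.pi → l ^ 2 < x ^ 2 + (l * ω + y) ^ 2 →
      ¬ ((Real.exp x * Real.cos y - (Real.exp (l * c) - r * c)) ^ 2 +
        (Real.exp x * Real.sin y - -(r * ω)) ^ 2 ≤ r ^ 2) := by
    intro x y him hn hle
    have hmem : Complex.exp (x + (l * ω + y) * Complex.I) ∈ Metric.closedBall p r := by
      rw [mem_closedBall_iff_norm, hdist]
      exact Real.sqrt_le_iff.2 ⟨(hS.trans hlt).le, hle⟩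
    have h1 := hmax _ hmem
    have h2 : (l : ℂ) * ω + y = ((l * ω + y : ℝ) : ℂ) := by push_cast; rfl
    rw [h2, log_exp_of_abs_im_lt (by simpa using him), Complex.norm_add_mul_I,
      Real.sqrt_le_iff] at h1
    linarith [h1.2]
  rcases eq_or_ne c 0 with hc | hc
  · subst hc
    rw [sinhDiv_zero_left] at hlt
    have hω2 : ω ^ 2 = 1 := by linarith
    -- For c = 0 the mirror point used below coincides with the tangency point, so a second-order
    -- test replaces it. The logarithm x + i(l-β)ω with x² = 2lβ has squared modulus l² + β², and
    -- membership in the disk becomes cosh x ≤ cos β + r sin β.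
    obtain ⟨β, hβ0, hβl, hβ⟩ := exists_cos_add_mul_sin_ge_exp hl hlt
    have hxx : Real.sqrt (2 * (l * β)) ^ 2 = 2 * (l * β) := Real.sq_sqrt (by positivity)
    set x := Real.sqrt (2 * (l * β))
    have hcosh : Real.cosh x ≤ Real.cos β + r * Real.sin β := by
      refine (Real.cosh_le_exp_half_sq x).trans ?_
      rw [hxx, mul_div_cancel_left₀ _ two_ne_zero]
      exact hβ
    have hω : ω = 1 ∨ ω = -1 := sq_eq_one_iff.1 hω2
    refine hcontra x (-(β * ω)) ?_ ?_ ?_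
    · rw [show l * ω + -(β * ω) = (l - β) * ω by ring, abs_mul, abs_of_pos (by linarith)]
      nlinarith
    · rw [hxx, show l * ω + -(β * ω) = (l - β) * ω by ring, mul_pow, hω2]
      nlinarith
    · have hcosβ : Real.cos (-(β * ω)) = Real.cos β := by
        rcases hω with rfl | rfl <;> simp
      have hsinβ : Real.sin (-(β * ω)) = -(ω * Real.sin β) := by
        rcases hω with rfl | rfl <;> simp
      rw [hcosβ, hsinβ]
      have h1 : Real.exp x * Real.cosh x ≤ Real.exp x * (Real.cos β + r * Real.sin β) := by
        gcongr
      have h2 : Real.exp x * Real.cosh x = (Real.exp x ^ 2 + 1) / 2 := by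
        have : Real.exp x * Real.exp (-x) = 1 := by rw [← Real.exp_add]; simp
        rw [Real.cosh_eq]
        linear_combination this / 2
      have h3 := Real.sin_sq_add_cos_sq β
      simp only [mul_zero, Real.exp_zero, sub_zero]
      have h4 : (Real.exp x * Real.cos β - 1) ^ 2 +
          (Real.exp x * -(ω * Real.sin β) - -(r * ω)) ^ 2 =
          Real.exp x ^ 2 + 1 - 2 * (Real.exp x * (Real.cos β + r * Real.sin β)) + r ^ 2 := by
        linear_combination Real.exp x ^ 2 * h3 +
          (Real.exp x ^ 2 * Real.sin β ^ 2 - 2 * r * Real.exp x * Real.sin β + r ^ 2) * hω2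
      rw [h4]
      linarith
  -- The mirror point with logarithm l(-c + iω) also has |log| = l. If r exceeds sinh(cl)/c it lies
  -- strictly inside the disk, so lengthening its logarithm slightly to (l+δ)(-c + iω) stays inside
  -- and contradicts maximality.
  · have hbase : (Real.exp (-(l * c)) - (Real.exp (l * c) - r * c)) ^ 2 + (r * ω) ^ 2 < r ^ 2 := by
      have h1 : Real.exp (l * c) - Real.exp (-(l * c)) = 2 * (c * sinhDiv c l) := by
        rw [mul_sinhDiv, Real.sinh_eq, mul_comm c l]
        ring
      have h2 : 0 < c ^ 2 := by positivity
      have h3 : (Real.exp (-(l * c)) - (Real.exp (l * c) - r * c)) ^ 2 + (r * ω) ^ 2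
          = r ^ 2 - 4 * c ^ 2 * sinhDiv c l * (r - sinhDiv c l) := by
        have : Real.exp (-(l * c)) - (Real.exp (l * c) - r * c) = r * c - 2 * (c * sinhDiv c l) := by
          linarith
        rw [this]
        linear_combination r ^ 2 * hcω
      have : 0 < 4 * c ^ 2 * sinhDiv c l * (r - sinhDiv c l) :=
        mul_pos (by positivity) (sub_pos.2 hlt)
      linarith
    have hcont : Continuous fun δ : ℝ =>
        (Real.exp (-((l + δ) * c)) * Real.cos (δ * ω) - (Real.exp (l * c) - r * c)) ^ 2 +
        (Real.exp (-((l + δ) * c)) * Real.sin (δ * ω) - -(r * ω)) ^ 2 := by fun_prop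
    have hev := (hcont.tendsto 0).eventually_lt_const (u := r ^ 2) (by simpa using hbase)
    obtain ⟨δ, hδ, hδ'⟩ := ((hev.filter_mono nhdsWithin_le_nhds).and
      (Ioo_mem_nhdsGT (sub_pos.2 hlπ))).exists
    refine hcontra (-((l + δ) * c)) (δ * ω) ?_ ?_ hδ.le
    · rw [show l * ω + δ * ω = (l + δ) * ω by ring, abs_mul, abs_of_pos (by linarith [hδ'.1])]
      nlinarith [hδ'.1, hδ'.2]
    · have : (-((l + δ) * c)) ^ 2 + (l * ω + δ * ω) ^ 2 = (l + δ) ^ 2 := by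
        linear_combination (l + δ) ^ 2 * hcω
      rw [this]
      nlinarith [hδ'.1]

/-- The left side is the modulus of the antilinear part of the flow at time `l`; it moves
continuously from 0 at ρ = 0 to `sinhDiv c l` at ρ = 1. -/
theorem exists_radius_eq {c r l : ℝ} (hr : 0 ≤ r) (hrl : r ≤ sinhDiv c l) :
    ∃ ρ ∈ Icc (0 : ℝ) 1, Real.exp ((1 - ρ) * c * l) * sinhDiv c (ρ * l) = r := by
  have hc : Continuous fun ρ : ℝ => Real.exp ((1 - ρ) * c * l) * sinhDiv c (ρ * l) := by
    have := continuous_sinhDiv c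
    fun_prop
  have := intermediate_value_Icc zero_le_one hc.continuousOn
  simp only [zero_mul, sinhDiv_zero, mul_zero, sub_self, Real.exp_zero, one_mul] at this
  exact this ⟨hr, hrl⟩

end Magnus

/-! ### Matching the two bounds. -/

namespace Magnus

open scoped ComplexConjugate

theorem magnusExponent_one : magnusExponent 1 ≤ ENNReal.ofReal 0 := by
  have h := magnusExponent_flow_le (c := 1) (ω := 0) (ρ := 0) (k := 1) (by norm_num) (by simp)
    (by simp) le_rfl
  simpa [flowLinear, flowAntilinear, sinhDiv_zero, pairMatrix_one] using h

/-- A matrix whose chiral disk is tangent to a level curve of `|log|`, with radius in the allowed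
range, has a presentation of the corresponding norm. -/
theorem magnusExponent_le_of_tangent {A : Matrix (Fin 2) (Fin 2) ℝ} {c ω l : ℝ}
    (hcω : c ^ 2 + ω ^ 2 = 1) (hl : 0 ≤ l)
    (hp : linearPart A = Complex.exp (l * ω * Complex.I) *
      (Real.exp (l * c) - ‖antilinearPart A‖ * (c + ω * Complex.I)))
    (hr : ‖antilinearPart A‖ ≤ sinhDiv c l) : magnusExponent A ≤ ENNReal.ofReal l := by
  obtain ⟨ρ, hρ, hρr⟩ := exists_radius_eq (norm_nonneg _) hr
  obtain ⟨k, hk, hkq⟩ : ∃ k : ℂ, ‖k‖ = 1 ∧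
      Complex.exp (l * ω * Complex.I) * (‖antilinearPart A‖ * k) = antilinearPart A := by
    rcases eq_or_ne (antilinearPart A) 0 with h0 | h0
    · exact ⟨1, by simp, by simp [h0]⟩
    · have hn : (‖antilinearPart A‖ : ℂ) ≠ 0 := by
        rw [Ne, Complex.ofReal_eq_zero, norm_eq_zero]
        exact h0
      have hE : ‖Complex.exp (l * ω * Complex.I)‖ = 1 := by
        have := Complex.norm_exp_ofReal_mul_I (l * ω)
        rwa [Complex.ofReal_mul] at this
      have hE0 := Complex.exp_ne_zero (l * ω * Complex.I)
      refine ⟨antilinearPart A / (Complex.exp (l * ω * Complex.I) * ‖antilinearPart A‖), ?_, ?_⟩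
      · rw [norm_div, norm_mul, hE, one_mul, Complex.norm_real, norm_norm,
          div_self (norm_ne_zero_iff.2 h0)]
      · field_simp
  have hexp : Complex.exp (l * ((1 - ρ) * c + ω * Complex.I)) =
      Complex.exp (l * ω * Complex.I) * Real.exp ((1 - ρ) * c * l) := by
    rw [Complex.ofReal_exp, ← Complex.exp_add]
    push_cast
    ring_nf
  have hr' : (Real.exp ((1 - ρ) * c * l) : ℂ) * sinhDiv c (ρ * l) = ‖antilinearPart A‖ := by
    rw [← hρr]
    push_cast
    rfl
  have hq : flowAntilinear c ω ρ k l = antilinearPart A := by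
    rw [flowAntilinear, hexp, ← hkq, ← hr']
    ring
  -- Substituting cosh = exp - sinh removes ρ: once the radius is right, the center of the flow
  -- automatically has the tangent form.
  have hcosh : Real.exp ((1 - ρ) * c * l) * Real.cosh (c * (ρ * l)) =
      Real.exp (l * c) - ‖antilinearPart A‖ * c := by
    have h1 : Real.cosh (c * (ρ * l)) = Real.exp (c * (ρ * l)) - c * sinhDiv c (ρ * l) := by
      rw [mul_sinhDiv, ← Real.cosh_add_sinh]
      ring
    have h2 : Real.exp (l * c) = Real.exp ((1 - ρ) * c * l) * Real.exp (c * (ρ * l)) := by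
      rw [← Real.exp_add]
      ring_nf
    rw [h1, h2, ← hρr]
    ring
  have hcosh' : (Real.exp ((1 - ρ) * c * l) : ℂ) * Real.cosh (c * (ρ * l)) =
      Real.exp (l * c) - ‖antilinearPart A‖ * c := by
    exact_mod_cast hcosh
  have hpe : flowLinear c ω ρ l = linearPart A := by
    rw [flowLinear, hexp, hp]
    linear_combination Complex.exp (l * ω * Complex.I) * hcosh' -
      Complex.exp (l * ω * Complex.I) * ω * Complex.I * hr'
  rw [← pairMatrix_linearPart_antilinearPart A, ← hpe, ← hq]
  exact magnusExponent_flow_le hcω hk hρ hl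

theorem log_of_mem_exp_ball {z : ℂ} (hz : z ∈ Complex.exp '' Metric.ball (0 : ℂ) Real.pi) :
    ‖Complex.log z‖ < Real.pi ∧ z ∈ Complex.slitPlane := by
  obtain ⟨w, hw, rfl⟩ := hz
  rw [mem_ball_zero_iff] at hw
  have him : |w.im| < Real.pi := (Complex.abs_im_le_norm w).trans_lt hw
  have hlog := log_exp_of_abs_im_lt him
  refine ⟨by rwa [hlog], Complex.mem_slitPlane_iff_arg.2 ⟨?_, Complex.exp_ne_zero w⟩⟩
  rw [← Complex.log_im, hlog]
  exact (abs_lt.1 him).2.ne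

/-- The Magnus exponent is the maximum of `|log|` on the chiral disk. -/
theorem magnusExponent_eq_of_isMax {A : Matrix (Fin 2) (Fin 2) ℝ}
    (hA : chiralDisk A ⊆ Complex.exp '' Metric.ball (0 : ℂ) Real.pi) {z₀ : ℂ}
    (hz₀ : z₀ ∈ chiralDisk A)
    (hmax : ∀ z ∈ chiralDisk A, ‖Complex.log z‖ ≤ ‖Complex.log z₀‖) :
    magnusExponent A = ENNReal.ofReal ‖Complex.log z₀‖ := by
  have hne : ∀ z ∈ chiralDisk A, z ≠ 0 := fun z hz =>
    Complex.slitPlane_ne_zero (log_of_mem_exp_ball (hA hz)).2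
  obtain ⟨hπ, hs⟩ := log_of_mem_exp_ball (hA hz₀)
  -- If the maximum is 0 there is no direction θ; the disk is then the single point 1 and `A` is the
  -- identity.
  rcases (norm_nonneg (Complex.log z₀)).eq_or_lt with h0 | hpos
  · have hone : ∀ z ∈ chiralDisk A, z = 1 := by
      intro z hz
      have h1 := hmax z hz
      rw [← h0, norm_le_zero_iff] at h1
      rw [← Complex.exp_log (hne z hz), h1, Complex.exp_zero]
    rw [chiralDisk_eq] at hone
    have hp : linearPart A = 1 := hone _ (Metric.mem_closedBall_self (norm_nonneg _))
    have hq : antilinearPart A = 0 := by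
      have := hone (linearPart A + antilinearPart A) (by simp)
      rw [hp] at this
      simpa using this
    rw [← h0]
    refine le_antisymm ?_ (by simp)
    rw [← pairMatrix_linearPart_antilinearPart A, hp, hq, pairMatrix_one]
    exact magnusExponent_one
  · set l := ‖Complex.log z₀‖ with hl
    set θ := (Complex.log z₀).arg with hθ
    have hw : (l : ℂ) * Complex.exp (θ * Complex.I) = Complex.log z₀ :=
      Complex.norm_mul_exp_arg_mul_I _
    have hz : Complex.exp (l * Complex.exp (θ * Complex.I)) = z₀ := by
      rw [hw, Complex.exp_log (hne z₀ hz₀)]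
    rw [chiralDisk_eq] at hmax hz₀
    have htan := sub_center_eq_of_isMax (p := linearPart A) (norm_nonneg (antilinearPart A)) hpos
      (by rwa [hz]) (by rw [hz, hw]) (by rwa [hz]) hmax
    refine le_antisymm ?_ (le_sInf ?_)
    · have hcω : Real.cos θ ^ 2 + Real.sin θ ^ 2 = 1 := Real.cos_sq_add_sin_sq θ
      have he : Complex.exp (θ * Complex.I) = Real.cos θ + Real.sin θ * Complex.I := by
        rw [Complex.exp_mul_I, Complex.ofReal_cos, Complex.ofReal_sin]
      have hE : Complex.exp (l * Complex.exp (θ * Complex.I)) =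
          Complex.exp (l * Real.sin θ * Complex.I) * Real.exp (l * Real.cos θ) := by
        rw [he, Complex.ofReal_exp, ← Complex.exp_add]
        push_cast
        ring_nf
      have hp : linearPart A = Complex.exp (l * Real.sin θ * Complex.I) *
          (Real.exp (l * Real.cos θ) -
            ‖antilinearPart A‖ * (Real.cos θ + Real.sin θ * Complex.I)) := by
        rw [hE, he] at htan
        linear_combination -htan
      exact magnusExponent_le_of_tangent hcω hpos.le hp
        (radius_le_sinhDiv hcω hpos hπ hp hmax)
    · rintro v ⟨a, b, φ, hφ, rfl⟩
      refine norm_log_le_cumulativeNorm hφ ?_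
      -- Tangency places `z₀` on the boundary circle, where the lower bound applies.
      rw [← hz, htan, norm_mul, norm_mul, Complex.norm_exp_ofReal_mul_I, ← Complex.ofReal_mul,
        Complex.norm_exp_ofReal_mul_I]
      simp

end Magnus

theorem mainTheorem10 (A : Matrix (Fin 2) (Fin 2) ℝ)
    (hA : Magnus.chiralDisk A ⊆ Complex.exp '' Metric.ball (0 : ℂ) Real.pi) :
    Magnus.magnusExponent A ≠ ⊤ ∧
    IsLeast {l : ℝ | l ∈ Set.Ico 0 Real.pi ∧
        Magnus.chiralDisk A ⊆ Complex.exp '' Metric.closedBall (0 : ℂ) l}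
      (Magnus.magnusExponent A).toReal ∧
    IsLUB ((fun z : ℂ => ‖Complex.log z‖) '' Magnus.chiralDisk A)
      (Magnus.magnusExponent A).toReal := by
  have hcont : ContinuousOn (fun z : ℂ => ‖Complex.log z‖) (Magnus.chiralDisk A) :=
    (continuousOn_id.clog fun z hz => (Magnus.log_of_mem_exp_ball (hA hz)).2).norm
  have hcomp : IsCompact (Magnus.chiralDisk A) := isCompact_closedBall _ _
  obtain ⟨z₀, hz₀, hmax⟩ := hcomp.exists_isMaxOn
    (Metric.nonempty_closedBall.2 (Real.sqrt_nonneg _)) hcont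
  have hM := Magnus.magnusExponent_eq_of_isMax hA hz₀ hmax
  have hMr : (Magnus.magnusExponent A).toReal = ‖Complex.log z₀‖ := by
    rw [hM, ENNReal.toReal_ofReal (norm_nonneg _)]
  refine ⟨by rw [hM]; exact ENNReal.ofReal_ne_top, ?_, ?_⟩
  · rw [hMr]
    refine ⟨⟨⟨norm_nonneg _, (Magnus.log_of_mem_exp_ball (hA hz₀)).1⟩, fun z hz => ?_⟩, ?_⟩
    · exact ⟨Complex.log z, mem_closedBall_zero_iff.2 (hmax hz), Complex.exp_log
        (Complex.slitPlane_ne_zero (Magnus.log_of_mem_exp_ball (hA hz)).2)⟩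
    · rintro l ⟨-, hl⟩
      -- Any admissible radius supplies some logarithm `w` of the maximum point, and none is shorter
      -- than the principal one.
      obtain ⟨w, hw, hwz⟩ := hl hz₀
      rw [← hwz]
      exact (Magnus.norm_log_exp_le w).trans (mem_closedBall_zero_iff.1 hw)
  · rw [hMr]
    refine IsGreatest.isLUB ⟨⟨z₀, hz₀, rfl⟩, ?_⟩
    rintro _ ⟨z, hz, rfl⟩
    exact hmax hz
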